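/- **Setting.** Let $D\ge 1$. There are $K$ arms; arm $i$ has a probability density $f_i$ on $\mathbb R^D$ with a unique global maximum point $m_i=\mathrm{mode}(f_i)$. Each $f_i$ is twice differentiable in a neighbourhood of $m_i$ with negative definite Hessian at $m_i$, and $\{f_i\ge c\}$ is compact for every $c>0$ (for example, $f_i$ is continuous on a compact support, or Hölder continuous on $\mathbb R^D$). Let $r:\mathbb R^D\to[0,1]$ be a Lipschitz score function, $\theta_i=r(m_i)$, with the arms indexed so that $\theta_1>\theta_2\ge\dots\ge\theta_K$ (the best arm is unique), and $\Delta_i=\theta_1-\theta_i$. The rewards $X_{i,t}$ (arm $i$, time $t=1,2,\dots$) are independent, and $X_{i,t}$ has density $f_i$. *Mode estimator.* For a finite nonempty $S\subset\mathbb R^D$ put $k=|S|^{4/(4+D)}$ and $r_k(x)=\inf\{\rho:|B(x,\rho)\cap S|\ge k\}$; $\widehat{\mathrm{mode}}(S)$ is a point of $\operatorname{argmin}_{x\in S}r_k(x)$, with an arbitrary tie-breaking rule. *Modal UCB with $n$ rounds and confidence parameter $\delta'$.* Let $I_t$ be the arm pulled at time $t$, $T_i(t)=|\{s\le t: I_s=i\}|$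 and $S_i(t)=\{X_{i,s}:s\le t,\ I_s=i\}$. At each $t=1,\dots,n$ the algorithm pulls an arm with $T_i(t-1)\le 1$ if there is one, and otherwise an arm $$I_t\in\operatorname*{argmax}_{i}\Big\{r\big(\widehat{\mathrm{mode}}(S_i(t-1))\big)+\frac{\log(1/\delta')\,\log T_i(t-1)}{T_i(t-1)^{1/(4+D)}}\Big\}.$$ Ties are broken arbitrarily, using only rewards from rounds before $t$. *Regrets.* $$\mathcal R(n)=n\max_i\theta_i-\sum_{t=1}^n\theta_{I_t},$$ $$\overline{\mathcal R}(n)=\max_i n\, r\big(\widehat{\mathrm{mode}}\{X_{i,t}:1\le t\le n\}\big)-\sum_{i=1}^K T_i(n)\, r\big(\widehat{\mathrm{mode}}\{X_{i,t}:I_t=i,\,1\le t\le n\}\big).$$ **Theorem.** For every $D\ge1$ there are real polynomials $P,Q$ in two variables and a constant $C>0$, depending only on $D$, such that the following holds. For all arms $f_1,\dots,f_K$ and every score function $r$ as above there is $N$, depending only on $f_1,\dots,f_K$ and $r$, such that for all $n\ge N$ and all $\delta\in(0,1)$, modal UCB with $n$ rounds and confidence parameter $\delta/n$ satisfies, with probability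 at least $1-\delta$, both $$\mathcal R(n)\le P\big(\log\tfrac1\delta,\log n\big)\sum_{i=2}^K\Delta_i^{-(3+D)}$$ and $$\overline{\mathcal R}(n)\le\mathcal R(n)+C\Big(Q\big(\log\tfrac1\delta,\log n\big)+K\Big)\,n^{\frac{3+D}{4+D}}.$$ -/

import Mathlib

open MeasureTheory ProbabilityTheory

namespace ModalBandit

/-- The reward space `ℝ^D` with the `ℓ²` norm. -/
abbrev Space (D : ℕ) : Type := EuclideanSpace ℝ (Fin D)

/-- `f` is a probability density on `ℝ^D` whose mode (global maximum point) is exactly `m`.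
It is twice differentiable around `m` with negative definite Hessian at `m`.
The condition on the superlevel sets says that `f` is upper semicontinuous and vanishes at
infinity; it holds if `f` is continuous on a compact support, and if `f` is Hölder continuous
on the whole of `ℝ^D`. No condition is put on other local maxima of `f`. -/
structure IsModalDensity {D : ℕ} (f : Space D → ℝ) (m : Space D) : Prop where
  nonneg : ∀ x, 0 ≤ f x
  lintegral_eq_one : ∫⁻ x, ENNReal.ofReal (f x) = 1
  isCompact_superlevel : ∀ c : ℝ, 0 < c → IsCompact {x | c ≤ f x}
  lt_mode : ∀ x, x ≠ m → f x < f m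
  twice_differentiable : ∀ᶠ x in nhds m, DifferentiableAt ℝ f x ∧ DifferentiableAt ℝ (fderiv ℝ f) x
  hessian_neg : ∀ v : Space D, v ≠ 0 → fderiv ℝ (fderiv ℝ f) m v v < 0

/-- The `k`-nearest-neighbour radius `r_k(x) = inf {ρ : |B(x, ρ) ∩ S| ≥ k}`. -/
noncomputable def knnRadius {D : ℕ} (k : ℝ) (S : Set (Space D)) (x : Space D) : ℝ :=
  sInf {ρ : ℝ | k ≤ ((Metric.closedBall x ρ ∩ S).ncard : ℝ)}

/-- The neighbourhood size `k = |S|^{4/(4+D)}` used on a sample `S`. -/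
noncomputable def knnSize {D : ℕ} (S : Set (Space D)) : ℝ :=
  (S.ncard : ℝ) ^ ((4 : ℝ) / (4 + D))

/-- `mhat` is the mode estimator: on a finite nonempty sample `S` it returns some element of
`argmin_{x ∈ S} r_k(x)` with `k = |S|^{4/(4+D)}`; the way ties are broken is arbitrary. -/
def IsModeEstimator {D : ℕ} (mhat : Set (Space D) → Space D) : Prop :=
  ∀ S : Set (Space D), S.Finite → S.Nonempty →
    mhat S ∈ S ∧ ∀ y ∈ S, knnRadius (knnSize S) S (mhat S) ≤ knnRadius (knnSize S) S y

section Bandit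

variable {D K : ℕ} {Ω : Type*}

/-- `X i t` is the reward of arm `i` at time `t` (times are `1, 2, …`): all these vectors are
independent, and those of arm `i` have density `f i`. -/
structure IsRewardTable [MeasurableSpace Ω] (μ : Measure Ω) (f : Fin K → Space D → ℝ)
    (X : Fin K → ℕ → Ω → Space D) : Prop where
  measurable : ∀ i t, Measurable (X i t)
  indep : iIndepFun (fun p : Fin K × ℕ => X p.1 p.2) μ
  law : ∀ i t, μ.map (X i t) = volume.withDensity (fun x => ENNReal.ofReal (f i x))

/-- `T_i(t)`: the number of pulls of arm `i` up to and including time `t`. -/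
def pulls (I : ℕ → Ω → Fin K) (i : Fin K) (t : ℕ) (ω : Ω) : ℕ :=
  ((Finset.Icc 1 t).filter (fun s => I s ω = i)).card

/-- `S_i(t)`: the rewards observed from arm `i` up to and including time `t`. -/
def observed (X : Fin K → ℕ → Ω → Space D) (I : ℕ → Ω → Fin K) (i : Fin K) (t : ℕ) (ω : Ω) :
    Set (Space D) :=
  {x | ∃ s, 1 ≤ s ∧ s ≤ t ∧ I s ω = i ∧ X i s ω = x}

/-- `{X_{i,t} : 1 ≤ t ≤ n}`: all the rewards of arm `i`, observed or not, up to time `n`. -/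
def fullSample (X : Fin K → ℕ → Ω → Space D) (i : Fin K) (n : ℕ) (ω : Ω) : Set (Space D) :=
  {x | ∃ s, 1 ≤ s ∧ s ≤ n ∧ X i s ω = x}

/-- The σ-algebra generated by the rewards of the rounds `1, …, t - 1`. -/
@[reducible] def past (X : Fin K → ℕ → Ω → Space D) (t : ℕ) : MeasurableSpace Ω :=
  ⨆ i : Fin K, ⨆ s : ℕ, ⨆ _ : 1 ≤ s ∧ s < t, MeasurableSpace.comap (X i s) inferInstance

/-- The upper confidence index of arm `i` after round `t`, with confidence parameter `δ`. -/
noncomputable def ucbIndex (r : Space D → ℝ) (mhat : Set (Space D) → Space D)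
    (X : Fin K → ℕ → Ω → Space D) (I : ℕ → Ω → Fin K) (δ : ℝ) (i : Fin K) (t : ℕ) (ω : Ω) : ℝ :=
  r (mhat (observed X I i t ω)) +
    Real.log (1 / δ) * Real.log (pulls I i t ω) / (pulls I i t ω : ℝ) ^ ((1 : ℝ) / (4 + D))

/-- `I` is a run of the UCB strategy over `n` rounds with confidence parameter `δ`.
The choice `I t` depends only on the rounds before `t`. As the confidence width is undefined for
`0` pulls and degenerates to `0` for `1` pull, an arm pulled fewer than twice has priority
(index `+∞`); otherwise an arm with the largest index is pulled, ties being broken arbitrarily. -/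
structure IsUCBRun (r : Space D → ℝ) (mhat : Set (Space D) → Space D)
    (X : Fin K → ℕ → Ω → Space D) (n : ℕ) (δ : ℝ) (I : ℕ → Ω → Fin K) : Prop where
  predictable : ∀ t, 1 ≤ t → t ≤ n → Measurable[past X t] (I t)
  initial : ∀ t, 1 ≤ t → t ≤ n → ∀ ω, (∃ i, pulls I i (t - 1) ω < 2) →
    pulls I (I t ω) (t - 1) ω < 2
  argmax : ∀ t, 1 ≤ t → t ≤ n → ∀ ω, (∀ i, 2 ≤ pulls I i (t - 1) ω) →
    ∀ j, ucbIndex r mhat X I δ j (t - 1) ω ≤ ucbIndex r mhat X I δ (I t ω) (t - 1) ω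

/-- The mode pseudo-regret `R(n) = n · max_i θ_i - ∑_{t=1}^n θ_{I_t}`. -/
noncomputable def modeRegret (θ : Fin K → ℝ) (I : ℕ → Ω → Fin K) (n : ℕ) (ω : Ω) : ℝ :=
  n * (⨆ i, θ i) - ∑ t ∈ Finset.Icc 1 n, θ (I t ω)

/-- The sample-mode regret
`max_i n · r(mhat{X_{i,t} : 1 ≤ t ≤ n}) - ∑_i T_i(n) · r(mhat{X_{i,t} : I_t = i, 1 ≤ t ≤ n})`. -/
noncomputable def sampleModeRegret (r : Space D → ℝ) (mhat : Set (Space D) → Space D)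
    (X : Fin K → ℕ → Ω → Space D) (I : ℕ → Ω → Fin K) (n : ℕ) (ω : Ω) : ℝ :=
  (⨆ i, n * r (mhat (fullSample X i n ω))) -
    ∑ i, (pulls I i n ω : ℝ) * r (mhat (observed X I i n ω))

end Bandit

/-- A polynomial `P` in the logarithms of two arguments. -/
noncomputable def polyLog (P : MvPolynomial (Fin 2) ℝ) (x y : ℝ) : ℝ :=
  MvPolynomial.eval ![Real.log x, Real.log y] P

end ModalBandit

open ModalBandit

/-!
With `l = log (n / δ)` and `h = T ^ (-1 / (4 + D))`, the confidence width of an arm pulled `T` times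
is `l h log T`. Everything rests on the fact that the estimated mode of `T` i.i.d. points is within
`√(M l) h` of the true mode up to probability `3 T exp (-l² / 8)`, where `M` depends on the density.
Since the width exceeds every constant multiple of `√l h` once `l` is large, and `l ≥ log n`, the
constants of the densities are absorbed by the condition `n ≥ N`.

**The mode estimator.** Here `k = T h ^ D = h ^ (-4)`. A density with negative definite Hessian at
its mode `m` lies between two parabolas near `m`, and the upper one, truncated, is a bound on the
whole space because superlevel sets are compact (`IsModalDensity.exists_shape`). Choose `ρ` such
that a ball of radius `ρ` on which the density equals its maximum has `k (1 + 2 l h²)` expected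
sample points (`exists_radius`). A centre within `h` of `m` loses only `O(k h²)` of these, and one
beyond `√(M l) h` loses at least `4 k l h²`; so the expected numbers of points differ from `k` by at
least `k l h² = l √k`, which is `l` standard deviations, in opposite directions. Chernoff bounds
show that the same holds for the actual numbers. No uniform law over balls is needed: only balls
centred at sample points matter, the other points are independent of the centre, and a union bound
over the `T` centres suffices (`measure_hits_closedBall_le`). Hence `IsModeEstimator.dist_lt`
applies, which gives `IsModalDensity.exists_concentration`. The argument needs `l h ≤ 2`; if
`l h > 2`, the width is larger than `1`, hence than any difference of scores.

**Adaptive samples.** The rewards observed from an arm are an initial segment of the rewards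
selected by a predictable rule, and these are again i.i.d. with the density of the arm
(`iIndepFun_sampled`, `map_sampled`). A union bound over the possible values of `T`, and over the
arms, makes all the widths correct up to probability `δ`.

**The regrets.** On that event a suboptimal arm is not pulled any more when its width is below half
of its gap (`IsUCBRun.pulls_le`), whence `modeRegret_le`. For the sample-mode regret each score is
compared with that of the true mode. With `a = (3 + D) / (4 + D)` the total error is
`∑ i, q T_i ^ a` where `q = l log n`, and as `a ≥ 1 / 2` it is at most `(K + q²) n ^ a` by the
inequality of arithmetic and geometric means (`mul_rpow_le_of_le`, `sampleModeRegret_le`).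
-/

namespace ModalBandit

universe u

/-! ### Shape of a modal density -/

section

/-- Second-order comparison along a segment. Applied to `t ↦ f (m + t v)`, it needs the derivative
of `f` at `m + t v` only up to `o(t)`, and no symmetry of the second derivative. -/
theorem le_add_of_deriv_le_two_mul {g g' : ℝ → ℝ} {a : ℝ}
    (hg : ∀ t ∈ Set.Icc (0 : ℝ) 1, HasDerivAt g (g' t) t)
    (hle : ∀ t ∈ Set.Icc (0 : ℝ) 1, g' t ≤ 2 * a * t) : g 1 ≤ g 0 + a := by
  have hd : ∀ t ∈ Set.Icc (0 : ℝ) 1,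
      HasDerivAt (fun t => g t - a * t ^ 2) (g' t - a * (2 * t)) t := by
    intro t ht
    exact ((hg t ht).sub ((hasDerivAt_pow 2 t).const_mul a)).congr_deriv (by simp)
  have hanti : AntitoneOn (fun t => g t - a * t ^ 2) (Set.Icc 0 1) := by
    refine antitoneOn_of_deriv_nonpos (convex_Icc 0 1)
      (fun t ht => (hd t ht).continuousAt.continuousWithinAt) ?_ ?_
    · intro t ht
      rw [interior_Icc] at ht
      exact (hd t (Set.Ioo_subset_Icc_self ht)).differentiableAt.differentiableWithinAt
    · intro t ht
      rw [interior_Icc] at ht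
      have ht' := Set.Ioo_subset_Icc_self ht
      rw [(hd t ht').deriv]
      linarith [hle t ht']
  have := hanti (Set.left_mem_Icc.2 zero_le_one) (Set.right_mem_Icc.2 zero_le_one) zero_le_one
  simp only at this
  linarith

theorem exists_forall_apply_le_neg_mul_sq {D : ℕ} (H : Space D →L[ℝ] Space D →L[ℝ] ℝ)
    (hH : ∀ v : Space D, v ≠ 0 → H v v < 0) :
    ∃ c : ℝ, 0 < c ∧ ∀ v, H v v ≤ -(c * ‖v‖ ^ 2) := by
  rcases (Metric.sphere (0 : Space D) 1).eq_empty_or_nonempty with he | hne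
  · refine ⟨1, one_pos, fun v => ?_⟩
    rcases eq_or_ne v 0 with rfl | hv
    · simp
    · exfalso
      have : (‖v‖⁻¹ • v) ∈ Metric.sphere (0 : Space D) 1 := by
        simp [norm_smul, hv]
      rw [he] at this
      exact this
  · have hcont : Continuous fun v : Space D => H v v := by fun_prop
    obtain ⟨u, hu, hmax⟩ := (isCompact_sphere (0 : Space D) 1).exists_isMaxOn hne hcont.continuousOn
    have hu1 : ‖u‖ = 1 := by simpa using hu
    have hu0 : u ≠ 0 := by
      rintro rfl
      simp at hu1
    refine ⟨-(H u u), by linarith [hH u hu0], fun v => ?_⟩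
    rcases eq_or_ne v 0 with rfl | hv
    · simp
    · have hv' : ‖v‖ ≠ 0 := norm_ne_zero_iff.2 hv
      have hmem : (‖v‖⁻¹ • v) ∈ Metric.sphere (0 : Space D) 1 := by
        simp [norm_smul, hv]
      have h1 : H (‖v‖⁻¹ • v) (‖v‖⁻¹ • v) ≤ H u u := hmax hmem
      have h2 : H (‖v‖⁻¹ • v) (‖v‖⁻¹ • v) * ‖v‖ ^ 2 = H v v := by
        simp only [map_smul, smul_eq_mul, smul_apply]
        field_simp
      have := mul_le_mul_of_nonneg_right h1 (sq_nonneg ‖v‖)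
      linarith

variable {D : ℕ} {f : Space D → ℝ} {m : Space D}

theorem IsModalDensity.le_mode (hf : IsModalDensity f m) (x : Space D) : f x ≤ f m := by
  rcases eq_or_ne x m with rfl | hx
  · exact le_rfl
  · exact (hf.lt_mode x hx).le

theorem IsModalDensity.mode_pos (hf : IsModalDensity f m) : 0 < f m := by
  by_contra! h
  have h0 : ∀ x, ENNReal.ofReal (f x) = 0 :=
    fun x => ENNReal.ofReal_eq_zero.2 ((hf.le_mode x).trans h)
  have := hf.lintegral_eq_one
  simp [h0] at this

/-- Second-order Taylor bounds at the mode. -/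
theorem IsModalDensity.exists_quadratic_bounds (hf : IsModalDensity f m) :
    ∃ c₁ c₂ R : ℝ, 0 < c₁ ∧ 0 < c₂ ∧ 0 < R ∧ ∀ y, dist y m < R →
      f m - c₁ * dist y m ^ 2 ≤ f y ∧ f y ≤ f m - c₂ * dist y m ^ 2 := by
  set H := fderiv ℝ (fderiv ℝ f) m with hHdef
  obtain ⟨c, hc, hHc⟩ := exists_forall_apply_le_neg_mul_sq H hf.hessian_neg
  have hcrit : fderiv ℝ f m = 0 :=
    IsLocalMax.fderiv_eq_zero (Filter.Eventually.of_forall hf.le_mode)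
  have hH : HasFDerivAt (fderiv ℝ f) H m :=
    hf.twice_differentiable.self_of_nhds.2.hasFDerivAt
  have hlo := (hasFDerivAt_iff_isLittleO.1 hH).def (half_pos hc)
  obtain ⟨R, hR, hball⟩ := Metric.eventually_nhds_iff.1 (hlo.and hf.twice_differentiable)
  refine ⟨(‖H‖ + c) / 2, c / 4, R, by positivity, by positivity, hR, fun y hy => ?_⟩
  set v := y - m with hv
  have hdist : dist y m = ‖v‖ := dist_eq_norm y m
  rw [hdist] at hy ⊢
  have hseg : ∀ t ∈ Set.Icc (0 : ℝ) 1, dist (m + t • v) m < R := by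
    intro t ht
    rw [dist_eq_norm, add_sub_cancel_left, norm_smul, Real.norm_of_nonneg ht.1]
    exact (mul_le_of_le_one_left (norm_nonneg _) ht.2).trans_lt hy
  have hderiv : ∀ t ∈ Set.Icc (0 : ℝ) 1,
      HasDerivAt (fun t : ℝ => f (m + t • v)) (fderiv ℝ f (m + t • v) v) t := by
    intro t ht
    have h1 : HasDerivAt (fun t : ℝ => m + t • v) v t := by
      simpa using ((hasDerivAt_id t).smul_const v).const_add m
    exact (hball (hseg t ht)).2.1.hasFDerivAt.comp_hasDerivAt t h1
  have hest : ∀ t ∈ Set.Icc (0 : ℝ) 1,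
      |fderiv ℝ f (m + t • v) v - t * H v v| ≤ c / 2 * t * ‖v‖ ^ 2 := by
    intro t ht
    have h1 := (hball (hseg t ht)).1
    rw [hcrit, sub_zero, add_sub_cancel_left, norm_smul, Real.norm_of_nonneg ht.1] at h1
    have h2 := ((fderiv ℝ f (m + t • v) - H (t • v)).le_opNorm v).trans
      (mul_le_mul_of_nonneg_right h1 (norm_nonneg v))
    simp only [sub_apply, map_smul, smul_apply,
      smul_eq_mul, Real.norm_eq_abs] at h2
    nlinarith [h2]
  have hHn : |H v v| ≤ ‖H‖ * ‖v‖ ^ 2 := by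
    have := H.le_opNorm₂ v v
    rw [Real.norm_eq_abs] at this
    nlinarith [this]
  have hend : m + v = y := by simp [hv]
  constructor
  · have := le_add_of_deriv_le_two_mul (g := fun t : ℝ => -f (m + t • v))
      (a := (‖H‖ + c) / 2 * ‖v‖ ^ 2) (fun t ht => (hderiv t ht).neg) (fun t ht => by
        have h1 := (abs_le.1 (hest t ht)).1
        have h2 := (abs_le.1 hHn).1
        have h3 : 0 ≤ t * ‖v‖ ^ 2 := mul_nonneg ht.1 (sq_nonneg _)
        nlinarith [mul_le_mul_of_nonneg_left h2 ht.1])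
    simp only [one_smul, zero_smul, add_zero, hend] at this
    linarith
  · have := le_add_of_deriv_le_two_mul (g := fun t : ℝ => f (m + t • v))
      (a := -(c / 4 * ‖v‖ ^ 2)) (fun t ht => hderiv t ht) (fun t ht => by
        have h1 := (abs_le.1 (hest t ht)).2
        nlinarith [mul_le_mul_of_nonneg_left (hHc v) ht.1])
    simp only [one_smul, zero_smul, add_zero, hend] at this
    linarith

/-- Away from the mode the density stays below its maximum by a fixed amount: otherwise the
superlevel sets, which are compact, would have a common point other than the mode. -/
theorem IsModalDensity.exists_gap (hf : IsModalDensity f m) {R : ℝ} (hR : 0 < R) :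
    ∃ η : ℝ, 0 < η ∧ ∀ y, R ≤ dist y m → f y ≤ f m - η := by
  by_contra! hcon
  have hF := hf.mode_pos
  let c : ℕ → ℝ := fun n => f m - f m / (n + 2)
  have hcpos : ∀ n, 0 < c n := by
    intro n
    have : f m / (n + 2) < f m := div_lt_self hF (by linarith [(Nat.cast_nonneg n : (0 : ℝ) ≤ n)])
    simp only [c]
    linarith
  let s : ℕ → Set (Space D) := fun n => {x | c n ≤ f x} ∩ {x | R ≤ dist x m}
  have hclosed : IsClosed {x : Space D | R ≤ dist x m} :=
    isClosed_le continuous_const (continuous_id.dist continuous_const)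
  have hne : (⋂ n, s n).Nonempty := by
    refine IsCompact.nonempty_iInter_of_sequence_nonempty_isCompact_isClosed s ?_ ?_ ?_ ?_
    · intro n x hx
      refine ⟨?_, hx.2⟩
      have h1 : c (n + 1) ≤ f x := hx.1
      refine le_trans ?_ h1
      simp only [c]
      push_cast
      gcongr
      linarith
    · intro n
      obtain ⟨y, hy, hlt⟩ := hcon (f m / (n + 2)) (by positivity)
      exact ⟨y, hlt.le, hy⟩
    · exact (hf.isCompact_superlevel _ (hcpos 0)).inter_right hclosed
    · exact fun n => (hf.isCompact_superlevel _ (hcpos n)).isClosed.inter hclosed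
  obtain ⟨x, hx⟩ := hne
  rw [Set.mem_iInter] at hx
  have hxm : x ≠ m := by
    rintro rfl
    have := (hx 0).2
    simp only [Set.mem_ofPred_eq, dist_self] at this
    linarith
  have hlim : Filter.Tendsto c Filter.atTop (nhds (f m - 0)) := by
    refine tendsto_const_nhds.sub ?_
    exact tendsto_const_nhds.div_atTop
      (Filter.tendsto_atTop_add_const_right _ 2 tendsto_natCast_atTop_atTop)
  have := le_of_tendsto' hlim (fun n => (hx n).1)
  linarith [hf.lt_mode x hxm]

/-- The shape of a modal density: a quadratic minorant near the mode and a quadratic majorant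
which, truncated at distance `R`, holds on the whole space. -/
theorem IsModalDensity.exists_shape (hf : IsModalDensity f m) :
    ∃ c₁ c₂ R : ℝ, 0 < c₁ ∧ 0 < c₂ ∧ 0 < R ∧
      (∀ y, dist y m ≤ R → f m - c₁ * dist y m ^ 2 ≤ f y) ∧
      (∀ a, 0 ≤ a → a ≤ R → ∀ y, a ≤ dist y m → f y ≤ f m - c₂ * a ^ 2) := by
  obtain ⟨c₁, c₂, R, hc₁, hc₂, hR, h⟩ := hf.exists_quadratic_bounds
  obtain ⟨η, hη, hgap⟩ := hf.exists_gap hR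
  refine ⟨c₁, min c₂ (η / R ^ 2), R / 2, hc₁, by positivity, by positivity,
    fun y hy => (h y (by linarith)).1, fun a ha haR y hy => ?_⟩
  rcases lt_or_ge (dist y m) R with hlt | hge
  · have h1 := (h y hlt).2
    have h2 : min c₂ (η / R ^ 2) * a ^ 2 ≤ c₂ * dist y m ^ 2 := by
      gcongr
      exact min_le_left _ _
    linarith
  · have h1 := hgap y hge
    have h2 : min c₂ (η / R ^ 2) * a ^ 2 ≤ η / R ^ 2 * R ^ 2 := by
      gcongr
      · exact min_le_right _ _
      · linarith
    rw [div_mul_cancel₀ _ (by positivity)] at h2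
    linarith

end

/-! ### Counting independent points in balls -/

section

section Counts

/-- The number of indices `l ∈ O` for which the point `y l` lies in `B`, as a real number. -/
noncomputable def hits {E ι : Type*} (B : Set E) (O : Finset ι) (y : ι → E) : ℝ :=
  ∑ l ∈ O, B.indicator (fun _ => (1 : ℝ)) (y l)

theorem hits_eq_card {E ι : Type*} (B : Set E) (O : Finset ι) (y : ι → E)
    [DecidablePred fun l => y l ∈ B] :
    hits B O y = ((O.filter fun l => y l ∈ B).card : ℝ) := by
  simp [hits, Set.indicator_apply]

theorem exp_sub_one_le_of_abs_le_one {t : ℝ} (ht : |t| ≤ 1) : Real.exp t - 1 ≤ t + t ^ 2 := by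
  have := (abs_le.1 (Real.abs_exp_sub_one_sub_id_le ht)).2
  linarith

variable {Ω E ι : Type*} [MeasurableSpace Ω] [MeasurableSpace E] {μ : Measure Ω}
  {Y : ι → Ω → E} {B : Set E} {p q a t : ℝ}

/-- The moment generating function of an indicator of probability `p` is at most
`exp (p (t + t ^ 2))`. -/
theorem mgf_indicator_le [IsProbabilityMeasure μ] {U : Ω → E} (hU : Measurable U)
    (hB : MeasurableSet B) (hp : μ.real (U ⁻¹' B) = p) (ht : |t| ≤ 1) :
    mgf (fun ω => B.indicator (fun _ => (1 : ℝ)) (U ω)) μ t ≤ Real.exp (p * (t + t ^ 2)) := by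
  have hp0 : 0 ≤ p := hp ▸ measureReal_nonneg
  have hfun : (fun ω => Real.exp (t * B.indicator (fun _ => (1 : ℝ)) (U ω))) =
      fun ω => 1 + (U ⁻¹' B).indicator (fun _ => Real.exp t - 1) ω := by
    funext ω
    by_cases h : U ω ∈ B
    · simp [h]
    · simp [h]
  have hmgf : mgf (fun ω => B.indicator (fun _ => (1 : ℝ)) (U ω)) μ t =
      1 + p * (Real.exp t - 1) := by
    rw [mgf, hfun, integral_add (integrable_const _)
      ((integrable_const _).indicator (hU hB)), integral_indicator_const _ (hU hB), hp]
    simp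
  rw [hmgf]
  have h1 := mul_le_mul_of_nonneg_left (exp_sub_one_le_of_abs_le_one ht) hp0
  linarith [Real.add_one_le_exp (p * (t + t ^ 2))]

theorem mgf_hits_le [IsProbabilityMeasure μ] (hY : iIndepFun Y μ) (hm : ∀ l, Measurable (Y l))
    (hB : MeasurableSet B) (hp : ∀ l, μ.real (Y l ⁻¹' B) = p) (ht : |t| ≤ 1) (O : Finset ι) :
    mgf (fun ω => hits B O fun l => Y l ω) μ t ≤ Real.exp (O.card * p * (t + t ^ 2)) := by
  have hmi : Measurable (B.indicator (fun _ => (1 : ℝ))) := measurable_const.indicator hB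
  have hind : iIndepFun (fun l ω => B.indicator (fun _ => (1 : ℝ)) (Y l ω)) μ :=
    hY.comp (fun _ => B.indicator (fun _ => (1 : ℝ))) (fun _ => hmi)
  have hsum : (fun ω => hits B O fun l => Y l ω) =
      ∑ l ∈ O, fun ω => B.indicator (fun _ => (1 : ℝ)) (Y l ω) := by
    funext ω
    simp [hits]
  rw [hsum, hind.mgf_sum (fun l => hmi.comp (hm l)) O]
  calc ∏ l ∈ O, mgf (fun ω => B.indicator (fun _ => (1 : ℝ)) (Y l ω)) μ t
      ≤ ∏ _l ∈ O, Real.exp (p * (t + t ^ 2)) :=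
        Finset.prod_le_prod (fun _ _ => mgf_nonneg)
          (fun l _ => mgf_indicator_le (hm l) hB (hp l) ht)
    _ = Real.exp (O.card * p * (t + t ^ 2)) := by
        rw [Finset.prod_const, ← Real.exp_nat_mul, mul_assoc]

theorem integrable_exp_mul_hits [IsProbabilityMeasure μ] (hm : ∀ l, Measurable (Y l))
    (hB : MeasurableSet B) (t : ℝ) (O : Finset ι) :
    Integrable (fun ω => Real.exp (t * hits B O fun l => Y l ω)) μ := by
  have hmi : Measurable (B.indicator (fun _ => (1 : ℝ))) := measurable_const.indicator hB
  have hmeas : Measurable fun ω => hits B O fun l => Y l ω :=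
    Finset.measurable_fun_sum O fun l _ => hmi.comp (hm l)
  refine Integrable.of_bound (C := Real.exp (|t| * O.card))
    ((hmeas.const_mul t).exp.aestronglyMeasurable) (Filter.Eventually.of_forall fun ω => ?_)
  rw [Real.norm_of_nonneg (Real.exp_pos _).le, Real.exp_le_exp]
  have h0 : 0 ≤ hits B O fun l => Y l ω :=
    Finset.sum_nonneg fun l _ => Set.indicator_nonneg (fun _ _ => zero_le_one) _
  have h1 : (hits B O fun l => Y l ω) ≤ O.card := by
    have : (hits B O fun l => Y l ω) ≤ ∑ _l ∈ O, (1 : ℝ) :=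
      Finset.sum_le_sum fun l _ => Set.indicator_le_self' (fun _ _ => zero_le_one) _
    simpa using this
  exact mul_le_mul (le_abs_self t) h1 h0 (abs_nonneg t)

/-- Upper tail of the Chernoff bound, in a form whose variance term is the mean. -/
theorem measure_le_hits_le [IsProbabilityMeasure μ] (hY : iIndepFun Y μ)
    (hm : ∀ l, Measurable (Y l)) (hB : MeasurableSet B) (hp : ∀ l, μ.real (Y l ⁻¹' B) = p)
    (O : Finset ι) (hq : O.card * p ≤ q) (ht0 : 0 ≤ t) (ht1 : t ≤ 1) :
    μ {ω | a ≤ hits B O fun l => Y l ω} ≤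
      ENNReal.ofReal (Real.exp (-(t * (a - q)) + q * t ^ 2)) := by
  have ht : |t| ≤ 1 := abs_le.2 ⟨by linarith, ht1⟩
  rw [← ofReal_measureReal]
  refine ENNReal.ofReal_le_ofReal ?_
  refine (measure_ge_le_exp_mul_mgf a ht0 (integrable_exp_mul_hits hm hB t O)).trans ?_
  refine (mul_le_mul_of_nonneg_left (mgf_hits_le hY hm hB hp ht O) (Real.exp_pos _).le).trans ?_
  rw [← Real.exp_add, Real.exp_le_exp]
  have := mul_le_mul_of_nonneg_right hq (by positivity : 0 ≤ t + t ^ 2)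
  linarith

/-- Lower tail of the Chernoff bound, in a form whose variance term is the mean. -/
theorem measure_hits_le_le [IsProbabilityMeasure μ] (hY : iIndepFun Y μ)
    (hm : ∀ l, Measurable (Y l)) (hB : MeasurableSet B) (hp : ∀ l, μ.real (Y l ⁻¹' B) = p)
    (O : Finset ι) (hq : q ≤ O.card * p) (ht0 : 0 ≤ t) (ht1 : t ≤ 1) :
    μ {ω | (hits B O fun l => Y l ω) ≤ a} ≤
      ENNReal.ofReal (Real.exp (-(t * (q - a)) + q * t ^ 2)) := by
  have ht : |-t| ≤ 1 := abs_le.2 ⟨by linarith, by linarith⟩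
  rw [← ofReal_measureReal]
  refine ENNReal.ofReal_le_ofReal ?_
  refine (measure_le_le_exp_mul_mgf a (neg_nonpos.2 ht0)
    (integrable_exp_mul_hits hm hB (-t) O)).trans ?_
  refine (mul_le_mul_of_nonneg_left (mgf_hits_le hY hm hB hp ht O) (Real.exp_pos _).le).trans ?_
  rw [← Real.exp_add, Real.exp_le_exp]
  have := mul_le_mul_of_nonneg_right hq (by nlinarith : 0 ≤ t - t ^ 2)
  nlinarith

/-- Freezing the first of two independent random variables: a bound that holds for each frozen
value holds for the joint event. -/
theorem measure_le_of_forall_section [IsProbabilityMeasure μ] {α β : Type*} [MeasurableSpace α]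
    [MeasurableSpace β] {U : Ω → α} {V : Ω → β} (hU : Measurable U) (hV : Measurable V)
    (h : IndepFun U V μ) {S : Set (α × β)} (hS : MeasurableSet S) {ε : ENNReal}
    (hε : ∀ x, μ {ω | (x, V ω) ∈ S} ≤ ε) : μ {ω | (U ω, V ω) ∈ S} ≤ ε := by
  have hmap := (indepFun_iff_map_prod_eq_prod_map_map hU.aemeasurable hV.aemeasurable).1 h
  have : IsProbabilityMeasure (μ.map U) := Measure.isProbabilityMeasure_map hU.aemeasurable
  have : IsProbabilityMeasure (μ.map V) := Measure.isProbabilityMeasure_map hV.aemeasurable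
  have h1 : μ {ω | (U ω, V ω) ∈ S} = μ.map (fun ω => (U ω, V ω)) S :=
    (Measure.map_apply (hU.prodMk hV) hS).symm
  rw [h1, hmap, Measure.prod_apply hS]
  calc ∫⁻ x, μ.map V (Prod.mk x ⁻¹' S) ∂μ.map U ≤ ∫⁻ _x, ε ∂μ.map U := by
        refine lintegral_mono fun x => ?_
        rw [Measure.map_apply hV (measurable_prodMk_left hS)]
        exact hε x
    _ = ε := by simp

end Counts

section LeaveOneOut

variable {Ω ι : Type*} {D : ℕ} [MeasurableSpace Ω] {μ : Measure Ω}
  {Y : ι → Ω → Space D}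

/-- Leave-one-out principle: an event about the number of sample points in the ball centred at
one of them (not counting that one) is no more likely than for the worst deterministic centre. -/
theorem measure_hits_closedBall_le [IsProbabilityMeasure μ] (hY : iIndepFun Y μ)
    (hm : ∀ l, Measurable (Y l)) {F : Set (Space D)} (hF : MeasurableSet F) {J : Set ℝ}
    (hJ : MeasurableSet J) (ρ : ℝ) {j : ι} {O : Finset ι} (hj : j ∉ O) {ε : ENNReal}
    (hε : ∀ x ∈ F, μ {ω | (hits (Metric.closedBall x ρ) O fun l => Y l ω) ∈ J} ≤ ε) :
    μ {ω | Y j ω ∈ F ∧ (hits (Metric.closedBall (Y j ω) ρ) O fun l => Y l ω) ∈ J} ≤ ε := by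
  have hind := hY.indepFun_finset {j} O (Finset.disjoint_singleton_left.2 hj) hm
  have hind' : IndepFun (Y j) (fun ω (l : O) => Y l ω) μ :=
    hind.comp (φ := fun z : ({j} : Finset ι) → Space D => z ⟨j, Finset.mem_singleton_self j⟩)
      (ψ := id) (measurable_pi_apply (⟨j, Finset.mem_singleton_self j⟩ : ({j} : Finset ι)))
      measurable_id
  let S : Set (Space D × (O → Space D)) :=
    {z | z.1 ∈ F ∧ (∑ l : O, (Metric.closedBall z.1 ρ).indicator (fun _ => (1 : ℝ)) (z.2 l)) ∈ J}
  have hsum : Measurable fun z : Space D × (O → Space D) =>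
      ∑ l : O, (Metric.closedBall z.1 ρ).indicator (fun _ => (1 : ℝ)) (z.2 l) := by
    refine Finset.measurable_fun_sum _ fun l _ => ?_
    have hset : MeasurableSet {z : Space D × (O → Space D) | dist (z.2 l) z.1 ≤ ρ} :=
      measurableSet_le (((measurable_pi_apply l).comp measurable_snd).dist measurable_fst)
        measurable_const
    exact (measurable_const (a := (1 : ℝ))).indicator hset
  have hS : MeasurableSet S := (measurable_fst hF).inter (hsum hJ)
  have hconv : ∀ x ω, (∑ l : O, (Metric.closedBall x ρ).indicator (fun _ => (1 : ℝ)) (Y l ω)) =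
      hits (Metric.closedBall x ρ) O fun l => Y l ω :=
    fun x ω => Finset.sum_coe_sort O
      fun l => (Metric.closedBall x ρ).indicator (fun _ => (1 : ℝ)) (Y l ω)
  have := measure_le_of_forall_section (hm j) (measurable_pi_lambda _ fun l : O => hm l) hind' hS
    (ε := ε) (fun x => by
      by_cases hx : x ∈ F
      · refine (measure_mono ?_).trans (hε x hx)
        rintro ω ⟨-, h⟩
        have h' : (∑ l : O, (Metric.closedBall x ρ).indicator (fun _ => (1 : ℝ)) (Y l ω)) ∈ J := h
        rw [hconv] at h'
        exact h'
      · refine (measure_mono (t := ∅) ?_).trans (by simp)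
        rintro ω ⟨h, -⟩
        exact hx h)
  refine (measure_mono ?_).trans this
  rintro ω ⟨h1, h2⟩
  refine ⟨h1, ?_⟩
  have : (∑ l : O, (Metric.closedBall (Y j ω) ρ).indicator (fun _ => (1 : ℝ)) (Y l ω)) ∈ J := by
    rw [hconv]
    exact h2
  exact this

theorem measure_eq_eq_zero [IsProbabilityMeasure μ] (hY : iIndepFun Y μ)
    (hm : ∀ l, Measurable (Y l)) (hna : ∀ l x, μ (Y l ⁻¹' {x}) = 0) {j l : ι} (hjl : j ≠ l) :
    μ {ω | Y j ω = Y l ω} = 0 := by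
  refine le_antisymm ?_ zero_le
  exact measure_le_of_forall_section (hm j) (hm l) (hY.indepFun hjl)
    (S := {z : Space D × Space D | z.1 = z.2}) (measurableSet_eq_fun measurable_fst measurable_snd)
    (fun x => (measure_mono fun ω (h : x = Y l ω) => h.symm).trans (hna l x).le)

end LeaveOneOut

end

/-! ### Nearest-neighbour radii and ball probabilities -/

section

section NearestNeighbours

variable {D : ℕ} {S : Set (Space D)} {k ρ : ℝ} {x : Space D}

theorem knnRadius_le (hk : 0 < k) (h : k ≤ ((Metric.closedBall x ρ ∩ S).ncard : ℝ)) :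
    knnRadius k S x ≤ ρ := by
  refine csInf_le ⟨0, fun r hr => ?_⟩ h
  by_contra! hneg
  have hr' : k ≤ ((Metric.closedBall x r ∩ S).ncard : ℝ) := hr
  rw [Metric.closedBall_eq_empty.2 hneg] at hr'
  simp at hr'
  linarith

/-- The infimum defining the `k`-nearest-neighbour radius of a finite sample is attained. -/
theorem le_ncard_of_knnRadius_le (hS : S.Finite) (hkS : k ≤ (S.ncard : ℝ))
    (h : knnRadius k S x ≤ ρ) : k ≤ ((Metric.closedBall x ρ ∩ S).ncard : ℝ) := by
  by_contra! hlt
  have hev : ∀ᶠ r in nhdsWithin ρ (Set.Ioi ρ), ∀ y ∈ S, ρ < dist y x → r < dist y x := by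
    refine (Filter.eventually_all_finite hS).2 fun y _ => ?_
    by_cases hy : ρ < dist y x
    · exact (Filter.Eventually.filter_mono nhdsWithin_le_nhds (eventually_lt_nhds hy)).mono
        fun r hr _ => hr
    · exact Filter.Eventually.of_forall fun r h' => absurd h' hy
  obtain ⟨r, hr, hρr⟩ := (hev.and self_mem_nhdsWithin).exists
  have hρr' : ρ < r := hρr
  have hball : Metric.closedBall x r ∩ S ⊆ Metric.closedBall x ρ ∩ S := by
    rintro y ⟨hy, hyS⟩
    refine ⟨?_, hyS⟩
    rw [Metric.mem_closedBall] at hy ⊢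
    by_contra! hcon
    exact absurd (hr y hyS hcon) (not_lt.2 hy)
  have hge : r ≤ knnRadius k S x := by
    refine le_csInf ?_ fun r' hr' => ?_
    · obtain ⟨R, hR⟩ := hS.isBounded.subset_closedBall x
      refine ⟨R, ?_⟩
      show k ≤ ((Metric.closedBall x R ∩ S).ncard : ℝ)
      rwa [Set.inter_eq_self_of_subset_right hR]
    · by_contra! hlt'
      have hr'' : k ≤ ((Metric.closedBall x r' ∩ S).ncard : ℝ) := hr'
      have hsub : Metric.closedBall x r' ∩ S ⊆ Metric.closedBall x ρ ∩ S :=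
        (Set.inter_subset_inter_left S (Metric.closedBall_subset_closedBall hlt'.le)).trans hball
      have := Set.ncard_le_ncard hsub (hS.inter_of_right _)
      have : ((Metric.closedBall x r' ∩ S).ncard : ℝ) ≤
        ((Metric.closedBall x ρ ∩ S).ncard : ℝ) := by exact_mod_cast this
      linarith
  linarith

/-- If some sample point has `k` neighbours within `ρ`, and no sample point at distance at least
`A` from `m` has, then the mode estimator is closer to `m` than `A`. -/
theorem IsModeEstimator.dist_lt {mhat : Set (Space D) → Space D} (hm : IsModeEstimator mhat)
    (hS : S.Finite) {x₀ m : Space D} {A : ℝ} (hx₀ : x₀ ∈ S)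
    (hnear : knnSize S ≤ ((Metric.closedBall x₀ ρ ∩ S).ncard : ℝ))
    (hfar : ∀ x ∈ S, A ≤ dist x m → ((Metric.closedBall x ρ ∩ S).ncard : ℝ) < knnSize S) :
    dist (mhat S) m < A := by
  obtain ⟨hmem, hmin⟩ := hm S hS ⟨x₀, hx₀⟩
  have hpos : 0 < S.ncard := (Set.ncard_pos hS).2 ⟨x₀, hx₀⟩
  have hone : (1 : ℝ) ≤ (S.ncard : ℝ) := by exact_mod_cast hpos
  have hkpos : 0 < knnSize S := Real.rpow_pos_of_pos (by linarith) _
  have hkle : knnSize S ≤ (S.ncard : ℝ) := by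
    refine (Real.rpow_le_rpow_of_exponent_le hone (y := (4 : ℝ) / (4 + D)) (z := 1) ?_).trans_eq
      (Real.rpow_one _)
    rw [div_le_one (by positivity)]
    linarith [(Nat.cast_nonneg D : (0 : ℝ) ≤ D)]
  by_contra! hcon
  have h1 := (hmin x₀ hx₀).trans (knnRadius_le hkpos hnear)
  exact absurd (le_ncard_of_knnRadius_le hS hkle h1) (not_le.2 (hfar _ hmem hcon))

/-- For pairwise distinct sample points, counting points of the sample in a set amounts to
counting indices. -/
theorem ncard_inter_image_eq_hits {y : ℕ → Space D} {T : ℕ} (hinj : Set.InjOn y (Set.Iio T))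
    (B : Set (Space D)) : ((B ∩ y '' Set.Iio T).ncard : ℝ) = hits B (Finset.range T) y := by
  classical
  rw [hits_eq_card]
  have h1 : B ∩ y '' Set.Iio T = y '' ↑((Finset.range T).filter fun l => y l ∈ B) := by
    ext z
    constructor
    · rintro ⟨hz, l, hl, rfl⟩
      exact ⟨l, by simpa using ⟨hl, hz⟩, rfl⟩
    · rintro ⟨l, hl, rfl⟩
      have hl' : l < T ∧ y l ∈ B := by simpa using hl
      exact ⟨hl'.2, l, hl'.1, rfl⟩
  have h2 : Set.InjOn y ↑((Finset.range T).filter fun l => y l ∈ B) := by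
    refine hinj.mono fun l hl => ?_
    have hl' : l < T ∧ y l ∈ B := by simpa using hl
    exact hl'.1
  rw [h1, h2.ncard_image, Set.ncard_coe_finset]

theorem hits_closedBall_self {y : ℕ → Space D} {T j : ℕ} (hj : j < T) (hρ : 0 ≤ ρ) :
    hits (Metric.closedBall (y j) ρ) (Finset.range T) y =
      1 + hits (Metric.closedBall (y j) ρ) ((Finset.range T).erase j) y := by
  rw [hits, hits, ← Finset.add_sum_erase _ _ (Finset.mem_range.2 hj)]
  simp [hρ]

end NearestNeighbours

section BallProbability

variable {D : ℕ} {f : Space D → ℝ} {m x : Space D} {c ρ : ℝ}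

theorem volume_real_closedBall (x : Space D) (hρ : 0 ≤ ρ) :
    (volume : Measure (Space D)).real (Metric.closedBall x ρ) =
      volume.real (Metric.ball (0 : Space D) 1) * ρ ^ D := by
  rw [measureReal_def, Measure.addHaar_closedBall _ _ hρ, ENNReal.toReal_mul,
    ENNReal.toReal_ofReal (by positivity), finrank_euclideanSpace_fin, measureReal_def, mul_comm]

theorem mul_volume_le_density (hf : IsModalDensity f m) (hρ : 0 ≤ ρ) (hc : 0 ≤ c)
    (h : ∀ y ∈ Metric.closedBall x ρ, c ≤ f y) :
    c * (volume.real (Metric.ball (0 : Space D) 1) * ρ ^ D) ≤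
      (volume.withDensity fun x => ENNReal.ofReal (f x)).real (Metric.closedBall x ρ) := by
  rw [← volume_real_closedBall x hρ, measureReal_def, measureReal_def,
    withDensity_apply _ measurableSet_closedBall, ← ENNReal.toReal_ofReal hc, ← ENNReal.toReal_mul]
  refine ENNReal.toReal_mono ?_ ?_
  · exact ne_top_of_le_ne_top ENNReal.one_ne_top
      (hf.lintegral_eq_one ▸ setLIntegral_le_lintegral _ _)
  · rw [← setLIntegral_const]
    exact setLIntegral_mono' measurableSet_closedBall
      fun y hy => ENNReal.ofReal_le_ofReal (h y hy)

theorem density_le_mul_volume (hρ : 0 ≤ ρ) (hc : 0 ≤ c)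
    (h : ∀ y ∈ Metric.closedBall x ρ, f y ≤ c) :
    (volume.withDensity fun x => ENNReal.ofReal (f x)).real (Metric.closedBall x ρ) ≤
      c * (volume.real (Metric.ball (0 : Space D) 1) * ρ ^ D) := by
  rw [← volume_real_closedBall x hρ, measureReal_def, measureReal_def,
    withDensity_apply _ measurableSet_closedBall, ← ENNReal.toReal_ofReal hc, ← ENNReal.toReal_mul]
  refine ENNReal.toReal_mono ?_ ?_
  · exact ENNReal.mul_ne_top ENNReal.ofReal_ne_top measure_closedBall_lt_top.ne
  · rw [← setLIntegral_const]
    exact setLIntegral_mono' measurableSet_closedBall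
      fun y hy => ENNReal.ofReal_le_ofReal (h y hy)

end BallProbability

set_option maxHeartbeats 400000 in
/-- The choice of the radius. With `h = T ^ (-1 / (4 + D))` and `k = h ^ (-4)`, the ball of radius
`ρ` at the mode is meant to contain about `k (1 + 2 s h²)` sample points; centres within `h` of
the mode lose at most half of the surplus, those beyond `√(M s) h` lose twice the surplus.
The hypotheses on `s` say only that it is large compared with the constants of the density. -/
theorem exists_radius {D : ℕ} (hD : 1 ≤ D) {F v c₁ c₂ R : ℝ} (hF : 0 < F) (hv : 0 < v)
    (hc₁ : 0 < c₁) (hc₂ : 0 < c₂) (hR : 0 < R) :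
    ∃ s₀ : ℝ, 16 ≤ s₀ ∧ ∀ s, s₀ ≤ s → ∀ h, 0 < h → s * h ≤ 2 → ∀ T : ℝ, T * h ^ (4 + D) = 1 →
      (h ≤ R ∧ c₁ * h ^ 2 ≤ F / 2 ∧ (s * h ^ 2) ^ 2 ≤ v * F) ∧
      ∃ ρ : ℝ, 0 < ρ ∧ h + ρ ≤ R ∧ c₁ * (h + ρ) ^ 2 ≤ F ∧
        (1 + s * h ^ 2) / h ^ 4 ≤ (T - 1) * ((F - c₁ * (h + ρ) ^ 2) * (v * ρ ^ D)) ∧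
        ∃ b : ℝ, 0 ≤ b ∧ b ≤ R ∧ b + ρ ≤ Real.sqrt (16 * F / c₂ * s) * h ∧ 0 ≤ F - c₂ * b ^ 2 ∧
          (T - 1) * ((F - c₂ * b ^ 2) * (v * ρ ^ D)) ≤ (1 - 2 * (s * h ^ 2)) / h ^ 4 := by
  set κ : ℝ := (3 / (v * F)) ^ ((D : ℝ)⁻¹) with hκ
  have hκ0 : 0 < κ := by positivity
  set M : ℝ := 16 * F / c₂ with hM
  have hM0 : 0 < M := by positivity
  set E : ℝ := 1 + c₁ * (1 + κ) ^ 2 / F with hE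
  have hE0 : 0 < E := by positivity
  -- the terms serve, in this order: `s h² ≤ 1 / 4`; the loss near the mode; `ρ` against the
  -- far distance; the far distance against `R`; `h + ρ ≤ R`; `(s h²)² ≤ v F`
  refine ⟨16 + 3 * E + 4 * κ ^ 2 / M + M / R ^ 2 + 2 * (1 + κ) / R + 16 / (v * F),
    by have : 0 < 3 * E + 4 * κ ^ 2 / M + M / R ^ 2 + 2 * (1 + κ) / R + 16 / (v * F) := by
         positivity
       linarith, fun s hs h hh hsh T hT => ?_⟩
  have p1 : 0 < 4 * κ ^ 2 / M := by positivity
  have p2 : 0 < M / R ^ 2 := by positivity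
  have p3 : 0 < 2 * (1 + κ) / R := by positivity
  have p4 : 0 < 16 / (v * F) := by positivity
  have s1 : 16 ≤ s := by linarith
  have s2 : 3 * E ≤ s := by linarith
  have s3 : 4 * κ ^ 2 ≤ s * M := (div_le_iff₀ hM0).1 (by linarith)
  have s4 : M ≤ s * R ^ 2 := (div_le_iff₀ (by positivity)).1 (by linarith)
  have s5 : 2 * (1 + κ) ≤ s * R := (div_le_iff₀ hR).1 (by linarith)
  have s6 : 16 ≤ s * (v * F) := (div_le_iff₀ (by positivity)).1 (by linarith)
  have s0 : 0 < s := by linarith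
  have h8 : h ≤ 1 / 8 := by linarith [mul_le_mul_of_nonneg_right s1 hh.le]
  -- the relative surplus `θ = s h²` is at most `4 / s`
  set θ : ℝ := s * h ^ 2 with hθ
  have hθ0 : 0 < θ := by positivity
  have hsθ : s * θ ≤ 4 := by
    have : s * θ = (s * h) ^ 2 := by rw [hθ]; ring
    rw [this]
    have h0 : 0 < s * h := by positivity
    exact (pow_le_pow_left₀ h0.le hsh 2).trans (by norm_num)
  have hθ4 : θ ≤ 1 / 4 := by linarith [mul_le_mul_of_nonneg_right s1 hθ0.le]
  have hκR : (1 + κ) * h ≤ R := by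
    have : s * ((1 + κ) * h) ≤ s * R := by
      linarith [mul_le_mul_of_nonneg_left hsh (by positivity : 0 ≤ 1 + κ)]
    exact le_of_mul_le_mul_left this s0
  have hκF : c₁ * ((1 + κ) * h) ^ 2 = (E - 1) * h ^ 2 * F := by
    rw [hE]; field_simp; ring
  have hEh : E * h ^ 2 ≤ 1 / 12 := by
    have : 3 * E * h ^ 2 ≤ s * h ^ 2 := by gcongr
    linarith
  have hE1 : 0 ≤ E - 1 := by
    rw [hE, add_sub_cancel_left]
    positivity
  have hEh' : (E - 1) * h ^ 2 ≤ 1 / 12 := by linarith [sq_nonneg h]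
  have hκF' : c₁ * ((1 + κ) * h) ^ 2 ≤ F / 2 := by
    rw [hκF]
    linarith [mul_le_mul_of_nonneg_right hEh' hF.le]
  have hhκ : h ≤ (1 + κ) * h := le_mul_of_one_le_left hh.le (by linarith)
  refine ⟨⟨hhκ.trans hκR, ?_, ?_⟩, ?_⟩
  · refine le_trans ?_ hκF'
    gcongr
  · have h1 : s * θ ^ 2 ≤ s * (v * F) := by
      linarith [mul_le_mul hsθ hθ4 hθ0.le (by norm_num)]
    exact le_of_mul_le_mul_left h1 s0
  set w : ℝ := ((1 + 2 * θ) / (v * F)) ^ ((D : ℝ)⁻¹) with hw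
  have hw0 : 0 < w := by positivity
  have hwκ : w ≤ κ := by
    refine Real.rpow_le_rpow (by positivity) ?_ (by positivity)
    gcongr
    linarith
  have hwD : w ^ D = (1 + 2 * θ) / (v * F) :=
    Real.rpow_inv_natCast_pow (by positivity) (by omega)
  have hvol : v * (w * h) ^ D = (1 + 2 * θ) / F * h ^ D := by
    rw [mul_pow, hwD]; field_simp
  have hsum : h + w * h ≤ (1 + κ) * h := by linarith [mul_le_mul_of_nonneg_right hwκ hh.le]
  have hTh : T * h ^ D = 1 / h ^ 4 := by
    rw [eq_div_iff (by positivity), ← hT]; ring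
  have hT1 : 1 ≤ T := by
    by_contra! hlt
    have h1 : h ^ (4 + D) ≤ 1 := pow_le_one₀ hh.le (by linarith)
    have h0 : 0 < h ^ (4 + D) := by positivity
    linarith [mul_lt_mul_of_pos_right hlt h0]
  have hTsub : (1 - h ^ 2) / h ^ 4 ≤ (T - 1) * h ^ D := by
    have : h ^ D ≤ 1 := pow_le_one₀ hh.le (by linarith)
    rw [sub_mul, hTh, one_mul, sub_div]
    have h2 : h ^ 2 / h ^ 4 = 1 / h ^ 2 := by field_simp
    have h3 : 1 ≤ 1 / h ^ 2 := by
      rw [le_div_iff₀ (by positivity), one_mul]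
      exact pow_le_one₀ hh.le (by linarith)
    linarith
  have hk0 : 0 < 1 / h ^ 4 := by positivity
  have hsumF : c₁ * (h + w * h) ^ 2 ≤ (E - 1) * h ^ 2 * F := by
    rw [← hκF]
    gcongr
  refine ⟨w * h, by positivity, by linarith, by linarith [mul_le_mul_of_nonneg_right hEh' hF.le],
    ?_, Real.sqrt (M * s) * h / 2,
    by positivity, ?_, ?_, ?_, ?_⟩
  · rw [hvol]
    have h1 : (1 + θ) / h ^ 4 ≤
        (1 - h ^ 2) / h ^ 4 * ((1 - (E - 1) * h ^ 2) * (1 + 2 * θ)) := by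
      have : (1 - h ^ 2) / h ^ 4 * ((1 - (E - 1) * h ^ 2) * (1 + 2 * θ)) =
        ((1 - h ^ 2) * ((1 - (E - 1) * h ^ 2) * (1 + 2 * θ))) / h ^ 4 := by ring
      rw [this]
      refine div_le_div_of_nonneg_right ?_ (by positivity)
      have h2 : 1 - E * h ^ 2 ≤ (1 - h ^ 2) * (1 - (E - 1) * h ^ 2) := by
        have : 0 ≤ h ^ 2 * ((E - 1) * h ^ 2) := by positivity
        linarith
      have h3 : 3 * E * h ^ 2 ≤ θ := by rw [hθ]; gcongr
      have h4 : 0 < E * h ^ 2 := by positivity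
      have h5 : E * h ^ 2 * (1 + 2 * θ) ≤ θ := by
        linarith [mul_le_mul_of_nonneg_left (by linarith : 1 + 2 * θ ≤ 3) h4.le]
      linarith [mul_le_mul_of_nonneg_right h2 (by linarith : 0 ≤ 1 + 2 * θ)]
    refine h1.trans ?_
    have h5 : (1 - (E - 1) * h ^ 2) * (1 + 2 * θ) ≤
        (F - c₁ * (h + w * h) ^ 2) * ((1 + 2 * θ) / F) := by
      have : (1 - (E - 1) * h ^ 2) * (1 + 2 * θ) =
        (F - (E - 1) * h ^ 2 * F) * ((1 + 2 * θ) / F) := by field_simp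
      rw [this]
      gcongr
    calc (1 - h ^ 2) / h ^ 4 * ((1 - (E - 1) * h ^ 2) * (1 + 2 * θ))
        ≤ (T - 1) * h ^ D * ((F - c₁ * (h + w * h) ^ 2) * ((1 + 2 * θ) / F)) := by
          refine mul_le_mul hTsub h5 ?_ ?_
          · have : 0 ≤ 1 - (E - 1) * h ^ 2 := by linarith
            positivity
          · have : 0 ≤ T - 1 := by linarith
            positivity
      _ = _ := by ring
  · have h1 : (Real.sqrt (M * s) * h / 2) ^ 2 ≤ R ^ 2 := by
      have : (Real.sqrt (M * s) * h / 2) ^ 2 = M * θ / 4 := by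
        rw [div_pow, mul_pow, Real.sq_sqrt (by positivity), hθ]; ring
      rw [this]
      have : s * (M * θ / 4) ≤ s * R ^ 2 := by
        linarith [mul_le_mul_of_nonneg_left hsθ hM0.le]
      exact le_of_mul_le_mul_left this s0
    exact le_of_sq_le_sq h1 hR.le
  · have h1 : 2 * κ ≤ Real.sqrt (M * s) := by
      refine Real.le_sqrt_of_sq_le ?_
      linarith
    linarith [mul_le_mul_of_nonneg_right h1 hh.le, mul_le_mul_of_nonneg_right hwκ hh.le]
  all_goals
    have hb : c₂ * (Real.sqrt (M * s) * h / 2) ^ 2 = 4 * θ * F := by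
      rw [div_pow, mul_pow, Real.sq_sqrt (by positivity), hM, hθ]; field_simp; ring
    rw [hb]
  · linarith [mul_le_mul_of_nonneg_right hθ4 hF.le]
  · rw [hvol]
    have h1 : (T - 1) * ((F - 4 * θ * F) * ((1 + 2 * θ) / F * h ^ D)) =
        (T * h ^ D - h ^ D) * ((1 - 4 * θ) * (1 + 2 * θ)) := by field_simp
    rw [h1, hTh]
    have h2 : 0 < h ^ D := by positivity
    have h3 : 0 ≤ (1 - 4 * θ) * (1 + 2 * θ) := by
      have : 0 ≤ 1 - 4 * θ := by linarith
      positivity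
    have h4 : (1 - 4 * θ) * (1 + 2 * θ) ≤ 1 - 2 * θ := by linarith [mul_pos hθ0 hθ0]
    calc (1 / h ^ 4 - h ^ D) * ((1 - 4 * θ) * (1 + 2 * θ))
        ≤ 1 / h ^ 4 * ((1 - 4 * θ) * (1 + 2 * θ)) := by
          exact mul_le_mul_of_nonneg_right (by linarith) h3
      _ ≤ 1 / h ^ 4 * (1 - 2 * θ) := by gcongr
      _ = _ := by ring

end

/-! ### Concentration of the mode estimator -/

section

theorem rpow_scale_pow_mul {D T : ℕ} (hT : 0 < T) :
    (T : ℝ) * ((T : ℝ) ^ (-((1 : ℝ) / (4 + D)))) ^ (4 + D) = 1 := by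
  have hT0 : (0 : ℝ) < T := by exact_mod_cast hT
  rw [← Real.rpow_natCast, ← Real.rpow_mul hT0.le]
  have : -((1 : ℝ) / (4 + D)) * ((4 + D : ℕ) : ℝ) = -1 := by
    push_cast
    have : (4 : ℝ) + D ≠ 0 := by positivity
    field_simp
  rw [this, Real.rpow_neg_one, mul_inv_cancel₀ hT0.ne']

theorem rpow_size_eq_scale {D T : ℕ} (hT : 0 < T) :
    (T : ℝ) ^ ((4 : ℝ) / (4 + D)) = 1 / ((T : ℝ) ^ (-((1 : ℝ) / (4 + D)))) ^ 4 := by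
  have hT0 : (0 : ℝ) < T := by exact_mod_cast hT
  rw [← Real.rpow_natCast, ← Real.rpow_mul hT0.le, one_div, ← Real.rpow_neg hT0.le]
  congr 1
  push_cast
  ring

variable {D : ℕ} {f : Space D → ℝ} {m : Space D}

/-- Concentration of the mode estimator on an i.i.d. sample of size `T` at confidence level `s`:
up to probability `3 T exp (-s² / 8)` the error is at most `√(M s) T ^ (-1 / (4 + D))`, as long
as `s T ^ (-1 / (4 + D))` is bounded. The constants depend only on the density. -/
theorem IsModalDensity.exists_concentration (hD : 1 ≤ D) (hf : IsModalDensity f m) :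
    ∃ M s₀ : ℝ, 0 < M ∧ ∀ s, s₀ ≤ s → ∀ T : ℕ, 0 < T →
      s * (T : ℝ) ^ (-((1 : ℝ) / (4 + D))) ≤ 2 →
      ∀ (Ω : Type u) [MeasurableSpace Ω] (μ : Measure Ω) [IsProbabilityMeasure μ]
        (Y : ℕ → Ω → Space D), iIndepFun Y μ → (∀ l, Measurable (Y l)) →
        (∀ l, μ.map (Y l) = volume.withDensity fun x => ENNReal.ofReal (f x)) →
        ∀ mhat : Set (Space D) → Space D, IsModeEstimator mhat →
        μ {ω | Real.sqrt (M * s) * (T : ℝ) ^ (-((1 : ℝ) / (4 + D))) ≤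
            dist (mhat ((fun l => Y l ω) '' Set.Iio T)) m} ≤
          ENNReal.ofReal (3 * T * Real.exp (-(s ^ 2 / 8))) := by
  obtain ⟨c₁, c₂, R, hc₁, hc₂, hR, hlow, hupp⟩ := hf.exists_shape
  have hF := hf.mode_pos
  set v : ℝ := (volume : Measure (Space D)).real (Metric.ball (0 : Space D) 1) with hv
  have hv0 : 0 < v := by
    rw [hv, measureReal_def]
    exact ENNReal.toReal_pos (Metric.measure_ball_pos _ _ one_pos).ne' measure_ball_lt_top.ne
  obtain ⟨s₀, hs₀, hrad⟩ := exists_radius hD hF hv0 hc₁ hc₂ hR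
  refine ⟨16 * f m / c₂, s₀, by positivity, fun s hs T hT hsT Ω _ μ _ Y hY hm hlaw mhat hmhat => ?_⟩
  have hTpos : (0 : ℝ) < T := by exact_mod_cast hT
  have hT1 : (1 : ℝ) ≤ T := by exact_mod_cast hT
  set h : ℝ := (T : ℝ) ^ (-((1 : ℝ) / (4 + D))) with hh
  have hh0 : 0 < h := by positivity
  obtain ⟨⟨hhR, hhF, hθvF⟩, ρ, hρ0, hρR, hρF, hnear, b, hb0, hbR, hbρ, hbF, hfar⟩ :=
    hrad s hs h hh0 hsT T (rpow_scale_pow_mul hT)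
  set A : ℝ := Real.sqrt (16 * f m / c₂ * s) * h with hA
  set k : ℝ := 1 / h ^ 4 with hk
  have hk0 : 0 < k := by positivity
  set θ : ℝ := s * h ^ 2 with hθ
  have hs16 : 16 ≤ s := hs₀.trans hs
  have hθ0 : 0 < θ := by positivity
  have hkθ2 : k * θ ^ 2 = s ^ 2 := by rw [hk, hθ]; field_simp
  have hθ1 : θ ≤ 1 / 4 := by
    have : s * θ ≤ 4 := by
      have h0 : s * θ = (s * h) ^ 2 := by rw [hθ]; ring
      rw [h0]
      exact (pow_le_pow_left₀ (by positivity) hsT 2).trans (by norm_num)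
    linarith [mul_le_mul_of_nonneg_right hs16 hθ0.le]
  have hh1 : h ≤ 1 := by linarith [mul_le_mul_of_nonneg_right hs16 hh0.le]
  have hkθ1 : 1 ≤ k * θ := by
    have h0 : k * θ = s / h ^ 2 := by rw [hk, hθ]; field_simp
    rw [h0, le_div_iff₀ (by positivity)]
    linarith [pow_le_one₀ hh0.le hh1 (n := 2)]
  have hprob : ∀ (x : Space D) (r : ℝ) (l : ℕ), μ.real (Y l ⁻¹' Metric.closedBall x r) =
      (volume.withDensity fun x => ENNReal.ofReal (f x)).real (Metric.closedBall x r) := by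
    intro x r l
    rw [measureReal_def, measureReal_def, ← hlaw l, Measure.map_apply (hm l)
      measurableSet_closedBall]
  have hcard : ∀ j, j < T → (((Finset.range T).erase j).card : ℝ) = T - 1 := by
    intro j hj
    rw [Finset.card_erase_of_mem (Finset.mem_range.2 hj), Finset.card_range,
      Nat.cast_sub hT, Nat.cast_one]
  set ε : ENNReal := ENNReal.ofReal (Real.exp (-(s ^ 2 / 8))) with hε
  -- some sample point is within `h` of the mode
  have hexists : μ {ω | (hits (Metric.closedBall m h) (Finset.range T) fun l => Y l ω) ≤ 0} ≤
      ε := by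
    have hmass : k * (v * f m / 2) ≤ ((Finset.range T).card : ℝ) *
        (volume.withDensity fun x => ENNReal.ofReal (f x)).real (Metric.closedBall m h) := by
      have h1 := mul_volume_le_density (x := m) (c := f m / 2) hf hh0.le (by linarith)
        (fun y hy => by
          have hy' : dist y m ≤ h := hy
          have h2 := hlow y (hy'.trans hhR)
          have h3 : c₁ * dist y m ^ 2 ≤ c₁ * h ^ 2 := by gcongr
          linarith)
      have h2 : k * (v * f m / 2) = T * (f m / 2 * (v * h ^ D)) := by
        have : (T : ℝ) * h ^ D = k := by
          rw [hk, eq_div_iff (by positivity), ← rpow_scale_pow_mul (D := D) hT, ← hh]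
          ring
        rw [← this]
        ring
      rw [h2, Finset.card_range]
      gcongr
    refine (measure_hits_le_le hY hm measurableSet_closedBall (fun l => hprob m h l) _ hmass
      (t := 1 / 2) (by norm_num) (by norm_num)).trans ?_
    refine ENNReal.ofReal_le_ofReal (Real.exp_le_exp.2 ?_)
    have := mul_le_mul_of_nonneg_left hθvF hk0.le
    rw [hkθ2] at this
    linarith
  -- sample points within `h` of the mode have `k` neighbours within `ρ`
  have hnearj : ∀ j, j < T → μ {ω | Y j ω ∈ Metric.closedBall m h ∧
      (hits (Metric.closedBall (Y j ω) ρ) ((Finset.range T).erase j) fun l => Y l ω) ∈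
        Set.Iic k} ≤ ε := by
    intro j hj
    refine measure_hits_closedBall_le hY hm measurableSet_closedBall measurableSet_Iic ρ
      (Finset.notMem_erase j _) fun x hx => ?_
    have hx' : dist x m ≤ h := hx
    have hmass := mul_volume_le_density (x := x) (c := f m - c₁ * (h + ρ) ^ 2) hf hρ0.le
      (by linarith) (fun y hy => by
        have hy' : dist y x ≤ ρ := hy
        have h1 : dist y m ≤ h + ρ := by linarith [dist_triangle y x m]
        have h2 := hlow y (h1.trans hρR)
        have h3 : c₁ * dist y m ^ 2 ≤ c₁ * (h + ρ) ^ 2 := by gcongr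
        linarith)
    have hq : k * (1 + θ) ≤ (((Finset.range T).erase j).card : ℝ) *
        (volume.withDensity fun x => ENNReal.ofReal (f x)).real (Metric.closedBall x ρ) := by
      rw [hcard j hj]
      refine (le_of_eq ?_).trans (hnear.trans (mul_le_mul_of_nonneg_left hmass (by linarith)))
      rw [hk]
      ring
    refine (measure_hits_le_le hY hm measurableSet_closedBall (fun l => hprob x ρ l) _ hq
      (a := k) (t := θ / 4) (by positivity) (by linarith)).trans ?_
    refine ENNReal.ofReal_le_ofReal (Real.exp_le_exp.2 ?_)
    have : -(θ / 4 * (k * (1 + θ) - k)) + k * (1 + θ) * (θ / 4) ^ 2 =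
      -(k * θ ^ 2 / 4) + k * θ ^ 2 * (1 + θ) / 16 := by ring
    rw [this, hkθ2]
    linarith [mul_le_mul_of_nonneg_left hθ1 (sq_nonneg s), sq_nonneg s]
  -- sample points beyond `A` do not
  have hfarj : ∀ j, j < T → μ {ω | Y j ω ∈ {x | A ≤ dist x m} ∧
      (hits (Metric.closedBall (Y j ω) ρ) ((Finset.range T).erase j) fun l => Y l ω) ∈
        Set.Ici (k - 1)} ≤ ε := by
    intro j hj
    refine measure_hits_closedBall_le hY hm
      (measurableSet_le measurable_const (measurable_id.dist measurable_const)) measurableSet_Ici ρ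
      (Finset.notMem_erase j _) fun x hx => ?_
    have hx' : A ≤ dist x m := hx
    have hmass := density_le_mul_volume (x := x) (f := f) (c := f m - c₂ * b ^ 2) hρ0.le hbF
      (fun y hy => by
        have hy' : dist y x ≤ ρ := hy
        have h1 : b ≤ dist y m := by linarith [dist_triangle_left x m y]
        exact hupp b hb0 hbR y h1)
    have hq : (((Finset.range T).erase j).card : ℝ) *
        (volume.withDensity fun x => ENNReal.ofReal (f x)).real (Metric.closedBall x ρ) ≤
          k * (1 - 2 * θ) := by
      rw [hcard j hj]
      refine ((mul_le_mul_of_nonneg_left hmass (by linarith)).trans hfar).trans (le_of_eq ?_)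
      rw [hk]
      ring
    refine (measure_le_hits_le hY hm measurableSet_closedBall (fun l => hprob x ρ l) _ hq
      (a := k - 1) (t := θ / 4) (by positivity) (by linarith)).trans ?_
    refine ENNReal.ofReal_le_ofReal (Real.exp_le_exp.2 ?_)
    have h1 : k * θ ≤ k - 1 - k * (1 - 2 * θ) := by linarith
    have h2 := mul_le_mul_of_nonneg_left h1 (by positivity : 0 ≤ θ / 4)
    have h3 : θ / 4 * (k * θ) = s ^ 2 / 4 := by rw [← hkθ2]; ring
    have h4 : k * (1 - 2 * θ) * (θ / 4) ^ 2 = s ^ 2 * (1 - 2 * θ) / 16 := by rw [← hkθ2]; ring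
    rw [h4]
    linarith [mul_nonneg (sq_nonneg s) hθ0.le]
  have hdistinct : ∀ j l, j ≠ l → μ {ω | Y j ω = Y l ω} = 0 := by
    intro j l hjl
    refine measure_eq_eq_zero hY hm (fun l x => ?_) hjl
    have : Nonempty (Fin D) := ⟨⟨0, hD⟩⟩
    rw [← Measure.map_apply (hm l) (measurableSet_singleton x), hlaw l]
    exact withDensity_absolutelyContinuous _ _ (measure_singleton x)
  -- outside of these events the nearest-neighbour comparison applies
  have hcover : {ω | A ≤ dist (mhat ((fun l => Y l ω) '' Set.Iio T)) m} ⊆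
      (⋃ j, ⋃ l, ⋃ _ : j ≠ l, {ω | Y j ω = Y l ω}) ∪
      ({ω | (hits (Metric.closedBall m h) (Finset.range T) fun l => Y l ω) ≤ 0} ∪
      ((⋃ j ∈ Finset.range T, {ω | Y j ω ∈ Metric.closedBall m h ∧
        (hits (Metric.closedBall (Y j ω) ρ) ((Finset.range T).erase j) fun l => Y l ω) ∈
          Set.Iic k}) ∪
      (⋃ j ∈ Finset.range T, {ω | Y j ω ∈ {x | A ≤ dist x m} ∧
        (hits (Metric.closedBall (Y j ω) ρ) ((Finset.range T).erase j) fun l => Y l ω) ∈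
          Set.Ici (k - 1)}))) := by
    intro ω hω
    by_contra hcon
    simp only [Set.mem_union, not_or, Set.mem_iUnion, not_exists] at hcon
    obtain ⟨hne, hsome, hn, hf'⟩ := hcon
    have hinj : Set.InjOn (fun l => Y l ω) (Set.Iio T) := by
      intro j _ l _ hjl
      by_contra hjl'
      exact hne j l hjl' hjl
    set S : Set (Space D) := (fun l => Y l ω) '' Set.Iio T with hS
    have hSfin : S.Finite := (Set.finite_Iio T).image _
    have hsize : knnSize S = k := by
      have : S.ncard = T := by
        rw [hS, hinj.ncard_image, ← Finset.coe_Iio, Set.ncard_coe_finset, Nat.card_Iio]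
      rw [knnSize, this, rpow_size_eq_scale hT, hk]
    obtain ⟨j₀, hj₀T, hj₀⟩ : ∃ j, j < T ∧ Y j ω ∈ Metric.closedBall m h := by
      by_contra! hnone
      have hz : (hits (Metric.closedBall m h) (Finset.range T) fun l => Y l ω) = 0 :=
        Finset.sum_eq_zero fun l hl =>
          Set.indicator_of_notMem (hnone l (Finset.mem_range.1 hl)) _
      exact hsome hz.le
    have hlt : dist (mhat S) m < A := by
      refine hmhat.dist_lt (ρ := ρ) hSfin (x₀ := Y j₀ ω) ⟨j₀, hj₀T, rfl⟩ ?_ ?_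
      · rw [hsize, hS, ncard_inter_image_eq_hits hinj,
          hits_closedBall_self (y := fun l => Y l ω) hj₀T hρ0.le]
        by_contra! hlt
        refine hn j₀ (Finset.mem_range.2 hj₀T) ⟨hj₀, ?_⟩
        rw [Set.mem_Iic]
        linarith
      · rintro x ⟨j, hjT, rfl⟩ hx
        have hjT' : j < T := hjT
        rw [hsize, hS, ncard_inter_image_eq_hits hinj,
          hits_closedBall_self (y := fun l => Y l ω) hjT' hρ0.le]
        by_contra! hge
        refine hf' j (Finset.mem_range.2 hjT') ⟨hx, ?_⟩
        rw [Set.mem_Ici]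
        linarith
    exact absurd hlt (not_lt.2 hω)
  have hsum : ∀ s : ℕ → Set Ω, (∀ j, j < T → μ (s j) ≤ ε) →
      μ (⋃ j ∈ Finset.range T, s j) ≤ T * ε := by
    intro s hs
    refine (measure_biUnion_finset_le _ _).trans ?_
    refine (Finset.sum_le_sum fun j hj => hs j (Finset.mem_range.1 hj)).trans ?_
    simp
  have hzero : μ (⋃ j, ⋃ l, ⋃ _ : j ≠ l, {ω | Y j ω = Y l ω}) = 0 := by
    simp only [measure_iUnion_null_iff]
    exact hdistinct
  calc μ {ω | A ≤ dist (mhat ((fun l => Y l ω) '' Set.Iio T)) m}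
      ≤ 0 + (ε + (T * ε + T * ε)) := by
        refine (measure_mono hcover).trans ((measure_union_le _ _).trans ?_)
        refine add_le_add hzero.le ((measure_union_le _ _).trans ?_)
        refine add_le_add hexists ((measure_union_le _ _).trans ?_)
        exact add_le_add (hsum _ hnearj) (hsum _ hfarj)
    _ ≤ T * ε + (T * ε + T * ε) := by
        rw [zero_add]
        gcongr
        have : (1 : ENNReal) ≤ T := by exact_mod_cast hT
        exact le_mul_of_one_le_left (zero_le) this
    _ = ENNReal.ofReal (3 * T * Real.exp (-(s ^ 2 / 8))) := by
        rw [ENNReal.ofReal_mul (by positivity), ENNReal.ofReal_mul (by norm_num),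
          ENNReal.ofReal_natCast, ← hε]
        simp only [ENNReal.ofReal_ofNat]
        ring

end

/-! ### Optional skipping -/

section

section OptionalSkipping

variable {Ω E : Type*} {m0 : MeasurableSpace Ω} [MeasurableSpace E] {μ : Measure Ω}
  {𝓕 : ℕ → MeasurableSpace Ω} {W : ℕ → Ω → E} {ν : Measure E} {sel : ℕ → Set Ω}

/-- The `j`-th of the values `W s` at the times `s` that are selected. -/
noncomputable def sampled (W : ℕ → Ω → E) (sel : ℕ → Set Ω) (j : ℕ) (ω : Ω) : E :=
  W (Nat.nth (fun s => ω ∈ sel s) j) ω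

/-- Whether `s` is the `j`-th selected time is known before `W s` is seen. -/
theorem measurableSet_nth_eq (hmono : Monotone 𝓕) (hsel : ∀ s, MeasurableSet[𝓕 s] (sel s))
    (hinf : ∀ ω, {s | ω ∈ sel s}.Infinite) (j s : ℕ) :
    MeasurableSet[𝓕 s] {ω | Nat.nth (fun s => ω ∈ sel s) j = s} := by
  classical
  have hcount : Measurable[𝓕 s] fun ω => ∑ u ∈ Finset.range s, (sel u).indicator (fun _ => 1) ω :=
    @Finset.measurable_fun_sum _ _ _ _ _ _ (𝓕 s) _ _ fun u hu =>
      (@measurable_const ℕ Ω _ (𝓕 s) 1).indicator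
        (hmono (Finset.mem_range.1 hu).le _ (hsel u))
  have heq : {ω | Nat.nth (fun s => ω ∈ sel s) j = s} =
      sel s ∩ (fun ω => ∑ u ∈ Finset.range s, (sel u).indicator (fun _ => 1) ω) ⁻¹' {j} := by
    ext ω
    have hc : (∑ u ∈ Finset.range s, (sel u).indicator (fun _ => 1) ω) =
        Nat.count (fun s => ω ∈ sel s) s := by
      rw [Nat.count_eq_card_filter_range, Finset.card_filter]
      simp [Set.indicator_apply]
    constructor
    · intro h
      have h' : Nat.nth (fun s => ω ∈ sel s) j = s := h
      refine ⟨h' ▸ Nat.nth_mem_of_infinite (hinf ω) j, ?_⟩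
      show (∑ u ∈ Finset.range s, (sel u).indicator (fun _ => 1) ω) = j
      rw [hc, ← h', Nat.count_nth_of_infinite (hinf ω)]
    · rintro ⟨h1, h2⟩
      have h2' : (∑ u ∈ Finset.range s, (sel u).indicator (fun _ => 1) ω) = j := h2
      rw [hc] at h2'
      show Nat.nth (fun s => ω ∈ sel s) j = s
      rw [← h2', Nat.nth_count h1]
  rw [heq]
  exact @MeasurableSet.inter _ (𝓕 s) _ _ (hsel s)
    (hcount (measurableSet_singleton j))

/-- Optional skipping: if the decision to select time `s` is taken before `W s`, which is
independent of the past, is seen, then the selected values are i.i.d. again. -/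
theorem measure_iInter_sampled_preimage [IsProbabilityMeasure μ] (hmono : Monotone 𝓕)
    (h𝓕 : ∀ s, 𝓕 s ≤ m0) (hW : ∀ s, Measurable[𝓕 (s + 1)] (W s))
    (hind : ∀ s, Indep (𝓕 s) (MeasurableSpace.comap (W s) inferInstance) μ)
    (hlaw : ∀ s, μ.map (W s) = ν) (hsel : ∀ s, MeasurableSet[𝓕 s] (sel s))
    (hinf : ∀ ω, {s | ω ∈ sel s}.Infinite) {A : ℕ → Set E} (hA : ∀ j, MeasurableSet (A j))
    (T : ℕ) :
    μ (⋂ j ∈ Finset.range T, sampled W sel j ⁻¹' A j) = ∏ j ∈ Finset.range T, ν (A j) := by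
  have hτ := measurableSet_nth_eq hmono hsel hinf
  have hWm : ∀ s, Measurable (W s) := fun s => (hW s).mono (h𝓕 _) le_rfl
  induction T with
  | zero => simp
  | succ T ih =>
    set τ : ℕ → Ω → ℕ := fun j ω => Nat.nth (fun s => ω ∈ sel s) j with hτdef
    set G : Set Ω := ⋂ j ∈ Finset.range T, sampled W sel j ⁻¹' A j with hG
    have hGs : ∀ s, MeasurableSet[𝓕 s] (G ∩ {ω | τ T ω = s}) := by
      intro s
      have heq : G ∩ {ω | τ T ω = s} = {ω | τ T ω = s} ∩
          ⋂ j ∈ Finset.range T, ⋃ u ∈ Finset.range s, ({ω | τ j ω = u} ∩ W u ⁻¹' A j) := by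
        ext ω
        simp only [hG, Set.mem_inter_iff, Set.mem_iInter, Set.mem_iUnion, Finset.mem_range]
        constructor
        · rintro ⟨h1, h2⟩
          have h2' : τ T ω = s := h2
          refine ⟨h2, fun j hj => ⟨τ j ω, ?_, rfl, h1 j hj⟩⟩
          rw [← h2']
          exact Nat.nth_strictMono (hinf ω) hj
        · rintro ⟨h1, h2⟩
          refine ⟨fun j hj => ?_, h1⟩
          obtain ⟨u, -, hu, hmem⟩ := h2 j hj
          have hu' : τ j ω = u := hu
          show W (τ j ω) ω ∈ A j
          rw [hu']
          exact hmem
      rw [heq]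
      refine @MeasurableSet.inter _ (𝓕 s) _ _ (hτ T s) ?_
      refine @Finset.measurableSet_biInter _ _ (𝓕 s) _ _ fun j _ => ?_
      refine @Finset.measurableSet_biUnion _ _ (𝓕 s) _ _ fun u hu => ?_
      have hu' := Finset.mem_range.1 hu
      exact @MeasurableSet.inter _ (𝓕 s) _ _ (hmono hu'.le _ (hτ j u))
        (hmono (Nat.succ_le_of_lt hu') _ (hW u (hA j)))
    have hsplit : ∀ H : Set Ω, H = ⋃ s, (H ∩ {ω | τ T ω = s}) := by
      intro H
      ext ω
      simp only [Set.mem_iUnion]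
      exact ⟨fun h => ⟨τ T ω, h, rfl⟩, fun ⟨_, h, _⟩ => h⟩
    have hdisj : ∀ H : ℕ → Set Ω, Pairwise (Function.onFun Disjoint
        fun s => H s ∩ {ω | τ T ω = s}) := by
      intro H s u hsu
      refine Set.disjoint_left.2 ?_
      rintro ω ⟨-, h1⟩ ⟨-, h2⟩
      have h1' : τ T ω = s := h1
      have h2' : τ T ω = u := h2
      exact hsu (h1'.symm.trans h2')
    -- on `τ T = s` the new value is `W s`, and the rest of the event belongs to its past
    have hstep : ∀ s, μ ((W s ⁻¹' A T ∩ G) ∩ {ω | τ T ω = s}) =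
        μ (G ∩ {ω | τ T ω = s}) * ν (A T) := by
      intro s
      rw [Set.inter_assoc, Set.inter_comm, ← hlaw s, Measure.map_apply (hWm s) (hA T)]
      exact (Indep_iff _ _ μ).1 (hind s) _ _ (hGs s) ⟨A T, hA T, rfl⟩
    have hnew : (⋂ j ∈ Finset.range (T + 1), sampled W sel j ⁻¹' A j) =
        ⋃ s, ((W s ⁻¹' A T ∩ G) ∩ {ω | τ T ω = s}) := by
      rw [Finset.range_add_one, Finset.set_biInter_insert, ← hG,
        hsplit (sampled W sel T ⁻¹' A T ∩ G)]
      refine Set.iUnion_congr fun s => ?_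
      ext ω
      constructor
      · rintro ⟨⟨h1, h2⟩, h3⟩
        have h3' : τ T ω = s := h3
        exact ⟨⟨h3' ▸ h1, h2⟩, h3⟩
      · rintro ⟨⟨h1, h2⟩, h3⟩
        have h3' : τ T ω = s := h3
        refine ⟨⟨?_, h2⟩, h3⟩
        show W (τ T ω) ω ∈ A T
        rw [h3']
        exact h1
    rw [hnew, measure_iUnion (hdisj _) fun s => ?_]
    · simp_rw [hstep]
      rw [ENNReal.tsum_mul_right, ← measure_iUnion (hdisj fun _ => G) fun s => h𝓕 s _ (hGs s),
        ← hsplit G, ih, Finset.prod_range_succ]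
    · rw [Set.inter_assoc]
      exact (hWm s (hA T)).inter (h𝓕 s _ (hGs s))

theorem measurable_sampled (hmono : Monotone 𝓕) (h𝓕 : ∀ s, 𝓕 s ≤ m0)
    (hW : ∀ s, Measurable[𝓕 (s + 1)] (W s)) (hsel : ∀ s, MeasurableSet[𝓕 s] (sel s))
    (hinf : ∀ ω, {s | ω ∈ sel s}.Infinite) (j : ℕ) : Measurable (sampled W sel j) := by
  intro B hB
  have heq : sampled W sel j ⁻¹' B =
      ⋃ s, ({ω | Nat.nth (fun s => ω ∈ sel s) j = s} ∩ W s ⁻¹' B) := by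
    ext ω
    simp only [Set.mem_iUnion]
    constructor
    · exact fun h => ⟨_, rfl, h⟩
    · rintro ⟨s, h1, h2⟩
      have h1' : Nat.nth (fun s => ω ∈ sel s) j = s := h1
      show W (Nat.nth (fun s => ω ∈ sel s) j) ω ∈ B
      rw [h1']
      exact h2
  rw [heq]
  exact MeasurableSet.iUnion fun s => (h𝓕 s _ (measurableSet_nth_eq hmono hsel hinf j s)).inter
    (h𝓕 _ _ (hW s hB))

theorem measure_sampled_preimage [IsProbabilityMeasure μ] (hmono : Monotone 𝓕)
    (h𝓕 : ∀ s, 𝓕 s ≤ m0) (hW : ∀ s, Measurable[𝓕 (s + 1)] (W s))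
    (hind : ∀ s, Indep (𝓕 s) (MeasurableSpace.comap (W s) inferInstance) μ)
    (hlaw : ∀ s, μ.map (W s) = ν) (hsel : ∀ s, MeasurableSet[𝓕 s] (sel s))
    (hinf : ∀ ω, {s | ω ∈ sel s}.Infinite) (j : ℕ) {B : Set E} (hB : MeasurableSet B) :
    μ (sampled W sel j ⁻¹' B) = ν B := by
  have hν : ν Set.univ = 1 := by
    rw [← hlaw 0, Measure.map_apply ((hW 0).mono (h𝓕 _) le_rfl) MeasurableSet.univ]
    simp
  have h := measure_iInter_sampled_preimage hmono h𝓕 hW hind hlaw hsel hinf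
    (A := fun l => if l = j then B else Set.univ)
    (fun l => by split_ifs <;> simp [hB]) (j + 1)
  have h1 : (⋂ l ∈ Finset.range (j + 1),
      sampled W sel l ⁻¹' (if l = j then B else Set.univ)) = sampled W sel j ⁻¹' B := by
    ext ω
    simp only [Set.mem_iInter, Finset.mem_range]
    constructor
    · intro hω
      simpa using hω j (Nat.lt_succ_self j)
    · intro hω l _
      by_cases hl : l = j
      · subst hl
        simpa using hω
      · simp [hl]
  have h2 : (∏ l ∈ Finset.range (j + 1), ν (if l = j then B else Set.univ)) = ν B := by
    rw [Finset.prod_eq_single j]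
    · simp
    · intro l _ hl
      simp [hl, hν]
    · simp
  rw [h1, h2] at h
  exact h

theorem map_sampled [IsProbabilityMeasure μ] (hmono : Monotone 𝓕)
    (h𝓕 : ∀ s, 𝓕 s ≤ m0) (hW : ∀ s, Measurable[𝓕 (s + 1)] (W s))
    (hind : ∀ s, Indep (𝓕 s) (MeasurableSpace.comap (W s) inferInstance) μ)
    (hlaw : ∀ s, μ.map (W s) = ν) (hsel : ∀ s, MeasurableSet[𝓕 s] (sel s))
    (hinf : ∀ ω, {s | ω ∈ sel s}.Infinite) (j : ℕ) : μ.map (sampled W sel j) = ν := by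
  ext B hB
  rw [Measure.map_apply (measurable_sampled hmono h𝓕 hW hsel hinf j) hB,
    measure_sampled_preimage hmono h𝓕 hW hind hlaw hsel hinf j hB]

theorem iIndepFun_sampled [IsProbabilityMeasure μ] (hmono : Monotone 𝓕)
    (h𝓕 : ∀ s, 𝓕 s ≤ m0) (hW : ∀ s, Measurable[𝓕 (s + 1)] (W s))
    (hind : ∀ s, Indep (𝓕 s) (MeasurableSpace.comap (W s) inferInstance) μ)
    (hlaw : ∀ s, μ.map (W s) = ν) (hsel : ∀ s, MeasurableSet[𝓕 s] (sel s))
    (hinf : ∀ ω, {s | ω ∈ sel s}.Infinite) : iIndepFun (sampled W sel) μ := by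
  classical
  refine iIndepFun_iff_measure_inter_preimage_eq_mul.2 fun S B hB => ?_
  have hν : ν Set.univ = 1 := by
    rw [← hlaw 0, Measure.map_apply ((hW 0).mono (h𝓕 _) le_rfl) MeasurableSet.univ]
    simp
  obtain ⟨T, hT⟩ := S.exists_nat_subset_range
  have h := measure_iInter_sampled_preimage hmono h𝓕 hW hind hlaw hsel hinf
    (A := fun l => if l ∈ S then B l else Set.univ)
    (fun l => by
      split_ifs with hl
      · exact hB l hl
      · exact MeasurableSet.univ) T
  have h1 : (⋂ l ∈ Finset.range T, sampled W sel l ⁻¹' (if l ∈ S then B l else Set.univ)) =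
      ⋂ l ∈ S, sampled W sel l ⁻¹' B l := by
    ext ω
    simp only [Set.mem_iInter]
    constructor
    · intro hω l hl
      simpa [hl] using hω l (hT hl)
    · intro hω l _
      by_cases hl : l ∈ S
      · simpa [hl] using hω l hl
      · simp [hl]
  have h2 : (∏ l ∈ Finset.range T, ν (if l ∈ S then B l else Set.univ)) = ∏ l ∈ S, ν (B l) := by
    rw [← Finset.prod_subset hT fun l _ hl => by simp [hl, hν]]
    exact Finset.prod_congr rfl fun l hl => by simp [hl]
  rw [h1, h2] at h
  rw [h]
  exact Finset.prod_congr rfl fun l hl =>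
    (measure_sampled_preimage hmono h𝓕 hW hind hlaw hsel hinf l (hB l hl)).symm

end OptionalSkipping

end

/-! ### Correctness of the confidence widths -/

section

section Score

variable {D : ℕ} {f : Space D → ℝ} {m : Space D}

/-- At level `l`, the score of the estimated mode of an i.i.d. sample of size `T` is off by at
most the confidence width. When `l T ^ (-1 / (4 + D))` is large the width exceeds `1` and there is
nothing to prove, so that concentration is only needed in the range where it is available. -/
theorem IsModalDensity.exists_score_concentration (hD : 1 ≤ D) (hf : IsModalDensity f m)
    {r : Space D → ℝ} {L : NNReal} (hL : LipschitzWith L r) (hr : ∀ x, r x ∈ Set.Icc (0 : ℝ) 1) :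
    ∃ l₀ : ℝ, ∀ l, l₀ ≤ l → ∀ T : ℕ, 2 ≤ T →
      ∀ (Ω : Type u) [MeasurableSpace Ω] (μ : Measure Ω) [IsProbabilityMeasure μ]
        (Y : ℕ → Ω → Space D), iIndepFun Y μ → (∀ j, Measurable (Y j)) →
        (∀ j, μ.map (Y j) = volume.withDensity fun x => ENNReal.ofReal (f x)) →
        ∀ mhat : Set (Space D) → Space D, IsModeEstimator mhat →
        μ {ω | l * Real.log T / (T : ℝ) ^ ((1 : ℝ) / (4 + D)) <
            |r (mhat ((fun j => Y j ω) '' Set.Iio T)) - r m|} ≤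
          ENNReal.ofReal (3 * T * Real.exp (-(l ^ 2 / 8))) := by
  obtain ⟨M, s₀, hM, hconc⟩ := hf.exists_concentration hD
  refine ⟨max 1 (max s₀ (4 * L ^ 2 * M)), fun l hl T hT Ω _ μ _ Y hY hm hlaw mhat hmhat => ?_⟩
  have hl1 : 1 ≤ l := (le_max_left _ _).trans hl
  have hl2 : s₀ ≤ l := ((le_max_left _ _).trans (le_max_right _ _)).trans hl
  have hl3 : 4 * (L : ℝ) ^ 2 * M ≤ l := ((le_max_right _ _).trans (le_max_right _ _)).trans hl
  have hTpos : (0 : ℝ) < T := by exact_mod_cast (by omega : 0 < T)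
  have hlog : 1 / 2 ≤ Real.log T := by
    have h1 : Real.log 2 ≤ Real.log T := Real.log_le_log (by norm_num) (by exact_mod_cast hT)
    linarith [Real.log_two_gt_d9]
  set h : ℝ := (T : ℝ) ^ (-((1 : ℝ) / (4 + D))) with hh
  have hh0 : 0 < h := by positivity
  have hwidth : l * Real.log T / (T : ℝ) ^ ((1 : ℝ) / (4 + D)) = l * Real.log T * h := by
    rw [hh, Real.rpow_neg hTpos.le, div_eq_mul_inv]
  rw [hwidth]
  rcases le_or_gt (l * h) 2 with hsmall | hlarge
  · refine le_trans (measure_mono fun ω hω => ?_)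
      (hconc l hl2 T (by omega) hsmall Ω μ Y hY hm hlaw mhat hmhat)
    have hω' : l * Real.log T * h < |r (mhat ((fun j => Y j ω) '' Set.Iio T)) - r m| := hω
    by_contra hcon
    have hcon' : dist (mhat ((fun j => Y j ω) '' Set.Iio T)) m < Real.sqrt (M * l) * h :=
      not_le.1 hcon
    have h1 := hL.dist_le_mul (mhat ((fun j => Y j ω) '' Set.Iio T)) m
    rw [Real.dist_eq] at h1
    have h2 : (L : ℝ) * Real.sqrt (M * l) ≤ l / 2 := by
      refine le_of_sq_le_sq ?_ (by positivity)
      rw [mul_pow, Real.sq_sqrt (by positivity)]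
      linarith [mul_le_mul_of_nonneg_right hl3 (by positivity : 0 ≤ l)]
    have h3 : (L : ℝ) * dist (mhat ((fun j => Y j ω) '' Set.Iio T)) m ≤
        L * (Real.sqrt (M * l) * h) := mul_le_mul_of_nonneg_left hcon'.le L.coe_nonneg
    have h4 := mul_le_mul_of_nonneg_right h2 hh0.le
    have h5 : l / 2 * h ≤ l * Real.log T * h := by
      refine mul_le_mul_of_nonneg_right ?_ hh0.le
      linarith [mul_le_mul_of_nonneg_left hlog (by linarith : 0 ≤ l)]
    linarith
  · refine (measure_mono (t := ∅) fun ω hω => ?_).trans (by simp)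
    have hω' : l * Real.log T * h < |r (mhat ((fun j => Y j ω) '' Set.Iio T)) - r m| := hω
    have h1 : |r (mhat ((fun j => Y j ω) '' Set.Iio T)) - r m| ≤ 1 := by
      have ha := hr (mhat ((fun j => Y j ω) '' Set.Iio T))
      have hb := hr m
      exact abs_le.2 ⟨by linarith [ha.1, hb.2], by linarith [ha.2, hb.1]⟩
    have h2 := mul_le_mul_of_nonneg_left hlog (by positivity : 0 ≤ l * h)
    exact absurd hω' (not_lt.2 (by linarith))

end Score

section RewardTable

variable {D K : ℕ} {Ω : Type u} {f : Fin K → Space D → ℝ}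
  {X : Fin K → ℕ → Ω → Space D} {I : ℕ → Ω → Fin K}

/-- The σ-algebra of all table entries at times before `t`, including the unused time `0`. -/
@[reducible] def tablePast (X : Fin K → ℕ → Ω → Space D) (t : ℕ) : MeasurableSpace Ω :=
  ⨆ p ∈ {p : Fin K × ℕ | p.2 < t}, MeasurableSpace.comap (X p.1 p.2) inferInstance

theorem past_le_tablePast (X : Fin K → ℕ → Ω → Space D) (t : ℕ) : past X t ≤ tablePast X t :=
  iSup_le fun i => iSup_le fun s => iSup_le fun hs =>
    le_iSup₂_of_le (f := fun (p : Fin K × ℕ) (_ : p ∈ {p : Fin K × ℕ | p.2 < t}) =>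
      MeasurableSpace.comap (X p.1 p.2) inferInstance) (i, s) hs.2 le_rfl

theorem tablePast_mono (X : Fin K → ℕ → Ω → Space D) : Monotone (tablePast X) :=
  fun _ _ hst => biSup_mono fun _ (hp : _ < _) => lt_of_lt_of_le hp hst

/-- The rounds in which arm `i` is pulled. Every round after the horizon `n` counts as one: this
makes the sequence of selected rewards infinite and does not affect the first `n` rounds. -/
def pullEvents (I : ℕ → Ω → Fin K) (i : Fin K) (n s : ℕ) : Set Ω :=
  {ω | 1 ≤ s ∧ (s ≤ n → I s ω = i)}

theorem IsRewardTable.tablePast_le [mΩ : MeasurableSpace Ω] {μ : Measure Ω}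
    (hX : IsRewardTable μ f X) (t : ℕ) : tablePast X t ≤ mΩ :=
  iSup₂_le fun p _ => (hX.measurable p.1 p.2).comap_le

theorem IsRewardTable.indep_tablePast [MeasurableSpace Ω] {μ : Measure Ω}
    (hX : IsRewardTable μ f X) (i : Fin K) (t : ℕ) :
    Indep (tablePast X t) (MeasurableSpace.comap (X i t) inferInstance) μ := by
  have h := indep_iSup_of_disjoint (fun p : Fin K × ℕ => (hX.measurable p.1 p.2).comap_le)
    hX.indep (S := {p : Fin K × ℕ | p.2 < t}) (T := {(i, t)})
    (Set.disjoint_singleton_right.2 fun h : t < t => lt_irrefl t h)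
  simpa only [Set.mem_singleton_iff, iSup_iSup_eq_left] using h

theorem measurable_tablePast_succ (X : Fin K → ℕ → Ω → Space D) (i : Fin K) (t : ℕ) :
    Measurable[tablePast X (t + 1)] (X i t) :=
  measurable_iff_comap_le.2 (le_iSup₂_of_le
    (f := fun (p : Fin K × ℕ) (_ : p ∈ {p : Fin K × ℕ | p.2 < t + 1}) =>
      MeasurableSpace.comap (X p.1 p.2) inferInstance) (i, t) (Nat.lt_succ_self t) le_rfl)

theorem measurableSet_pullEvents {n : ℕ}
    (hI : ∀ t, 1 ≤ t → t ≤ n → Measurable[past X t] (I t)) (i : Fin K) (s : ℕ) :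
    MeasurableSet[tablePast X s] (pullEvents I i n s) := by
  by_cases h1 : 1 ≤ s
  · by_cases h2 : s ≤ n
    · have heq : pullEvents I i n s = I s ⁻¹' {i} := by
        ext ω
        exact ⟨fun h => h.2 h2, fun h => ⟨h1, fun _ => h⟩⟩
      rw [heq]
      exact past_le_tablePast X s _ (hI s h1 h2 (measurableSet_singleton i))
    · have heq : pullEvents I i n s = Set.univ := by
        ext ω
        exact ⟨fun _ => trivial, fun _ => ⟨h1, fun h => absurd h h2⟩⟩
      rw [heq]
      exact @MeasurableSet.univ _ (tablePast X s)
  · have heq : pullEvents I i n s = ∅ := by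
      ext ω
      exact ⟨fun h => h1 h.1, fun h => h.elim⟩
    rw [heq]
    exact @MeasurableSet.empty _ (tablePast X s)

theorem infinite_pullEvents (I : ℕ → Ω → Fin K) (i : Fin K) (n : ℕ) (ω : Ω) :
    {s | ω ∈ pullEvents I i n s}.Infinite := by
  refine (Set.Ioi_infinite n).mono fun s hs => ?_
  have hs' : n < s := hs
  exact ⟨by omega, fun h => absurd h (by omega)⟩

theorem count_pullEvents {i : Fin K} {n t : ℕ} (ht : t ≤ n) (ω : Ω)
    [DecidablePred fun s => ω ∈ pullEvents I i n s] :
    Nat.count (fun s => ω ∈ pullEvents I i n s) (t + 1) = pulls I i t ω := by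
  rw [Nat.count_eq_card_filter_range, pulls]
  congr 1
  ext s
  simp only [Finset.mem_filter, Finset.mem_range, Finset.mem_Icc]
  constructor
  · rintro ⟨h1, h2, h3⟩
    exact ⟨⟨h2, by omega⟩, h3 (by omega)⟩
  · rintro ⟨⟨h1, h2⟩, h3⟩
    exact ⟨by omega, h1, fun _ => h3⟩

/-- The rewards observed from an arm are an initial segment of its sequence of selected rewards. -/
theorem observed_eq_image {i : Fin K} {n t : ℕ} (ht : t ≤ n) (ω : Ω) :
    observed X I i t ω =
      (fun j => sampled (X i) (pullEvents I i n) j ω) '' Set.Iio (pulls I i t ω) := by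
  classical
  have hinf := infinite_pullEvents I i n ω
  ext x
  constructor
  · rintro ⟨s, h1, h2, h3, rfl⟩
    have hs : ω ∈ pullEvents I i n s := ⟨h1, fun _ => h3⟩
    refine ⟨Nat.count (fun s => ω ∈ pullEvents I i n s) s, ?_, ?_⟩
    · rw [Set.mem_Iio, ← count_pullEvents ht ω]
      exact Nat.count_strict_mono hs (Nat.lt_succ_of_le h2)
    · show X i (Nat.nth (fun s => ω ∈ pullEvents I i n s) _) ω = X i s ω
      rw [Nat.nth_count hs]
  · rintro ⟨j, hj, rfl⟩
    rw [Set.mem_Iio, ← count_pullEvents ht ω] at hj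
    have hmem : ω ∈ pullEvents I i n (Nat.nth (fun s => ω ∈ pullEvents I i n s) j) :=
      Nat.nth_mem_of_infinite hinf j
    have hlt := Nat.nth_lt_of_lt_count hj
    exact ⟨_, hmem.1, by omega, hmem.2 (by omega), rfl⟩

theorem fullSample_eq_image (i : Fin K) (n : ℕ) (ω : Ω) :
    fullSample X i n ω = (fun j => X i (j + 1) ω) '' Set.Iio n := by
  ext x
  constructor
  · rintro ⟨s, h1, h2, rfl⟩
    exact ⟨s - 1, by rw [Set.mem_Iio]; omega, by dsimp only; rw [Nat.sub_add_cancel h1]⟩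
  · rintro ⟨j, hj, rfl⟩
    rw [Set.mem_Iio] at hj
    exact ⟨j + 1, by omega, by omega, rfl⟩

end RewardTable

end

/-! ### Regret on the good event -/

section

section Regret

variable {D K : ℕ} {Ω : Type*} {X : Fin K → ℕ → Ω → Space D} {I : ℕ → Ω → Fin K}

theorem sum_pulls_mul (I : ℕ → Ω → Fin K) (n : ℕ) (ω : Ω) (g : Fin K → ℝ) :
    ∑ t ∈ Finset.Icc 1 n, g (I t ω) = ∑ i, (pulls I i n ω : ℝ) * g i := by
  rw [← Finset.sum_fiberwise (Finset.Icc 1 n) (fun t => I t ω) fun t => g (I t ω)]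
  refine Finset.sum_congr rfl fun i _ => ?_
  rw [Finset.sum_congr rfl fun t ht => by rw [(Finset.mem_filter.1 ht).2],
    Finset.sum_const, nsmul_eq_mul, pulls]

theorem sum_pulls (I : ℕ → Ω → Fin K) (n : ℕ) (ω : Ω) :
    ∑ i, (pulls I i n ω : ℝ) = n := by
  have := sum_pulls_mul I n ω fun _ => 1
  simpa using this.symm

theorem pulls_le (I : ℕ → Ω → Fin K) (i : Fin K) (n : ℕ) (ω : Ω) : pulls I i n ω ≤ n := by
  refine (Finset.card_filter_le _ _).trans ?_
  simp

theorem exists_last_pull {i : Fin K} {n : ℕ} {ω : Ω} (h : 0 < pulls I i n ω) :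
    ∃ t, 1 ≤ t ∧ t ≤ n ∧ I t ω = i ∧ pulls I i n ω = pulls I i (t - 1) ω + 1 := by
  induction n with
  | zero => simp [pulls] at h
  | succ n ih =>
    by_cases hI : I (n + 1) ω = i
    · refine ⟨n + 1, by omega, le_rfl, hI, ?_⟩
      rw [pulls, ← Finset.insert_Icc_right_eq_Icc_add_one (by omega), Finset.filter_insert,
        if_pos hI,
        Finset.card_insert_of_notMem (by simp)]
      rfl
    · have heq : pulls I i (n + 1) ω = pulls I i n ω := by
        rw [pulls, ← Finset.insert_Icc_right_eq_Icc_add_one (by omega), Finset.filter_insert,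
          if_neg hI]
        rfl
      rw [heq] at h ⊢
      obtain ⟨t, h1, h2, h3, h4⟩ := ih h
      exact ⟨t, h1, by omega, h3, h4⟩

theorem modeRegret_eq_sum {θ : Fin K → ℝ} {best : Fin K} (hbest : ∀ i, θ i ≤ θ best) (n : ℕ)
    (ω : Ω) : modeRegret θ I n ω = ∑ i, (pulls I i n ω : ℝ) * (θ best - θ i) := by
  have : Nonempty (Fin K) := ⟨best⟩
  have hsup : (⨆ i, θ i) = θ best :=
    le_antisymm (ciSup_le hbest) (le_ciSup (Set.finite_range θ).bddAbove best)
  rw [modeRegret, hsup, ← sum_pulls_mul I n ω fun i => θ best - θ i, Finset.sum_sub_distrib]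
  simp

/-- The index comparison at the last pull of arm `i`: a suboptimal arm is no longer pulled once
its confidence width has fallen below half of its gap. -/
theorem IsUCBRun.pulls_le {r : Space D → ℝ} {mhat : Set (Space D) → Space D} {n : ℕ} {δ l : ℝ}
    (hrun : IsUCBRun r mhat X n δ I) {θ : Fin K → ℝ} {best i : Fin K} {ω : Ω}
    (hl : Real.log (1 / δ) = l) (hl0 : 0 ≤ l) (hbig : 1 ≤ 2 * l * Real.log n)
    (hgap : 0 < θ best - θ i) (hgap1 : θ best - θ i ≤ 1)
    (hgood : ∀ j, ∀ t ≤ n, 2 ≤ pulls I j t ω → |r (mhat (observed X I j t ω)) - θ j| ≤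
      l * Real.log (pulls I j t ω) / (pulls I j t ω : ℝ) ^ ((1 : ℝ) / (4 + D))) :
    (pulls I i n ω : ℝ) ≤ 2 * (2 * l * Real.log n / (θ best - θ i)) ^ (4 + D) := by
  set Z : ℝ := 2 * l * Real.log n / (θ best - θ i) with hZ
  have hZ1 : 1 ≤ Z := by
    rw [hZ, le_div_iff₀ hgap]
    linarith
  have hZpow : 1 ≤ Z ^ (4 + D) := one_le_pow₀ hZ1
  rcases Nat.lt_or_ge (pulls I i n ω) 3 with hlt | hge
  · have : (pulls I i n ω : ℝ) ≤ 2 := by exact_mod_cast (by omega : pulls I i n ω ≤ 2)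
    linarith
  · obtain ⟨t, ht1, htn, hIt, hcount⟩ := exists_last_pull (I := I) (by omega : 0 < pulls I i n ω)
    set T : ℕ := pulls I i (t - 1) ω with hT
    have hT2 : 2 ≤ T := by omega
    have hall : ∀ j, 2 ≤ pulls I j (t - 1) ω := by
      by_contra! hcon
      have := hrun.initial t ht1 htn ω hcon
      rw [hIt] at this
      omega
    have harg := hrun.argmax t ht1 htn ω hall best
    rw [hIt, ucbIndex, ucbIndex, hl, ← hT] at harg
    have hb := (abs_le.1 (hgood best (t - 1) (by omega) (hall best))).1
    have hi := (abs_le.1 (hgood i (t - 1) (by omega) (hall i))).2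
    rw [← hT] at hi
    have hTpos : (0 : ℝ) < T := by exact_mod_cast (by omega : 0 < T)
    have hroot : (0 : ℝ) < (T : ℝ) ^ ((1 : ℝ) / (4 + D)) := Real.rpow_pos_of_pos hTpos _
    have hgapw : θ best - θ i ≤ 2 * l * Real.log T / (T : ℝ) ^ ((1 : ℝ) / (4 + D)) := by
      have : 2 * l * Real.log T / (T : ℝ) ^ ((1 : ℝ) / (4 + D)) =
        2 * (l * Real.log T / (T : ℝ) ^ ((1 : ℝ) / (4 + D))) := by ring
      rw [this]
      linarith
    have hTn : T ≤ n := ModalBandit.pulls_le I i (t - 1) ω |>.trans (by omega)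
    have hlogT : Real.log T ≤ Real.log n := Real.log_le_log hTpos (by exact_mod_cast hTn)
    have hrootZ : (T : ℝ) ^ ((1 : ℝ) / (4 + D)) ≤ Z := by
      rw [le_div_iff₀ hroot] at hgapw
      rw [hZ, le_div_iff₀ hgap]
      linarith [mul_le_mul_of_nonneg_left hlogT (by positivity : 0 ≤ 2 * l)]
    have hTZ : (T : ℝ) ≤ Z ^ (4 + D) := by
      have h1 : ((T : ℝ) ^ ((1 : ℝ) / (4 + D))) ^ (4 + D) = T := by
        have : (1 : ℝ) / (4 + D) = ((4 + D : ℕ) : ℝ)⁻¹ := by push_cast; rw [one_div]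
        rw [this, Real.rpow_inv_natCast_pow hTpos.le (by omega)]
      calc (T : ℝ) = ((T : ℝ) ^ ((1 : ℝ) / (4 + D))) ^ (4 + D) := h1.symm
        _ ≤ Z ^ (4 + D) := pow_le_pow_left₀ hroot.le hrootZ _
    rw [hcount]
    push_cast
    linarith

theorem modeRegret_le {r : Space D → ℝ} {mhat : Set (Space D) → Space D} {n : ℕ} {δ l : ℝ}
    (hrun : IsUCBRun r mhat X n δ I) {θ : Fin K → ℝ} {best : Fin K} {ω : Ω}
    (hl : Real.log (1 / δ) = l) (hl0 : 0 ≤ l) (hbig : 1 ≤ 2 * l * Real.log n)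
    (hθ : ∀ i, θ i ∈ Set.Icc (0 : ℝ) 1) (hbest : ∀ i, i ≠ best → θ i < θ best)
    (hgood : ∀ j, ∀ t ≤ n, 2 ≤ pulls I j t ω → |r (mhat (observed X I j t ω)) - θ j| ≤
      l * Real.log (pulls I j t ω) / (pulls I j t ω : ℝ) ^ ((1 : ℝ) / (4 + D))) :
    modeRegret θ I n ω ≤ 2 * (2 * l * Real.log n) ^ (4 + D) *
      ∑ i with i ≠ best, (θ best - θ i) ^ (-((3 : ℝ) + D)) := by
  have hbest' : ∀ i, θ i ≤ θ best := by
    intro i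
    rcases eq_or_ne i best with rfl | hi
    · exact le_rfl
    · exact (hbest i hi).le
  rw [modeRegret_eq_sum hbest', Finset.mul_sum,
    ← Finset.sum_filter_add_sum_filter_not Finset.univ (fun i => i ≠ best)]
  have hzero : ∑ i with ¬ i ≠ best, (pulls I i n ω : ℝ) * (θ best - θ i) = 0 := by
    refine Finset.sum_eq_zero fun i hi => ?_
    have : i = best := by simpa using hi
    rw [this]
    ring
  rw [hzero, add_zero]
  refine Finset.sum_le_sum fun i hi => ?_
  have hgap : 0 < θ best - θ i := by linarith [hbest i (Finset.mem_filter.1 hi).2]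
  have h1 := hrun.pulls_le hl hl0 hbig hgap (by linarith [(hθ best).2, (hθ i).1]) hgood
  have h2 : (θ best - θ i) ^ (-((3 : ℝ) + D)) = (θ best - θ i) / (θ best - θ i) ^ (4 + D) := by
    rw [← Real.rpow_natCast, eq_div_iff (by positivity), ← Real.rpow_add hgap]
    convert Real.rpow_one _ using 2
    push_cast
    ring
  calc (pulls I i n ω : ℝ) * (θ best - θ i)
      ≤ 2 * (2 * l * Real.log n / (θ best - θ i)) ^ (4 + D) * (θ best - θ i) :=
        mul_le_mul_of_nonneg_right h1 hgap.le
    _ = _ := by rw [h2, div_pow]; ring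

/-- The estimation error of an arm pulled `T ≤ n` times, weighted by `T`. The arithmetic-geometric
mean inequality turns `q T ^ a`, with `a ≥ 1 / 2`, into `n ^ a` times a constant plus a multiple of
the share `T / n`, and the shares of the arms sum to one. -/
theorem mul_rpow_le_of_le {a q : ℝ} {T n : ℕ} (ha : 1 / 2 ≤ a) (hq : 0 ≤ q) (hTn : T ≤ n)
    (hn : 0 < n) : q * (T : ℝ) ^ a ≤ (1 + q ^ 2 * (T / n)) * (n : ℝ) ^ a := by
  have hn0 : (0 : ℝ) < n := by exact_mod_cast hn
  have hT0 : (0 : ℝ) ≤ T := Nat.cast_nonneg T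
  set x : ℝ := (T : ℝ) / n with hx
  have hx0 : 0 ≤ x := by positivity
  have hx1 : x ≤ 1 := by
    rw [hx, div_le_one hn0]
    exact_mod_cast hTn
  have h1 : (T : ℝ) ^ a = x ^ a * (n : ℝ) ^ a := by
    rw [← Real.mul_rpow hx0 hn0.le, hx, div_mul_cancel₀ _ hn0.ne']
  have h2 : x ^ a ≤ Real.sqrt x := by
    rw [Real.sqrt_eq_rpow]
    exact Real.rpow_le_rpow_of_exponent_ge' hx0 hx1 (by norm_num) ha
  have h3 : q * Real.sqrt x ≤ 1 + q ^ 2 * x := by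
    have h4 : q ^ 2 * x = (q * Real.sqrt x) ^ 2 := by rw [mul_pow, Real.sq_sqrt hx0]
    rw [h4]
    linarith [sq_nonneg (q * Real.sqrt x - 1), sq_nonneg (q * Real.sqrt x)]
  rw [h1, ← mul_assoc]
  exact mul_le_mul_of_nonneg_right ((mul_le_mul_of_nonneg_left h2 hq).trans h3) (by positivity)

theorem mul_div_rpow_eq {T : ℕ} (hT : 0 < T) (w : ℝ) :
    (T : ℝ) * (w / (T : ℝ) ^ ((1 : ℝ) / (4 + D))) =
      w * (T : ℝ) ^ (((3 : ℝ) + D) / (4 + D)) := by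
  have hT0 : (0 : ℝ) < T := by exact_mod_cast hT
  have hexp : ((3 : ℝ) + D) / (4 + D) = 1 - 1 / (4 + D) := by
    have : (4 : ℝ) + D ≠ 0 := by positivity
    field_simp
    ring
  rw [hexp, Real.rpow_sub hT0, Real.rpow_one]
  ring

theorem sampleModeRegret_le {r : Space D → ℝ} {mhat : Set (Space D) → Space D} {n : ℕ} {l : ℝ}
    {θ : Fin K → ℝ} {best : Fin K} {ω : Ω} (hn : 0 < n) (hl0 : 0 ≤ l)
    (hr : ∀ x, r x ∈ Set.Icc (0 : ℝ) 1)
    (hθ : ∀ i, θ i ∈ Set.Icc (0 : ℝ) 1) (hbest : ∀ i, θ i ≤ θ best)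
    (hgood : ∀ j, ∀ t ≤ n, 2 ≤ pulls I j t ω → |r (mhat (observed X I j t ω)) - θ j| ≤
      l * Real.log (pulls I j t ω) / (pulls I j t ω : ℝ) ^ ((1 : ℝ) / (4 + D)))
    (hfull : ∀ j, |r (mhat (fullSample X j n ω)) - θ j| ≤
      l * Real.log n / (n : ℝ) ^ ((1 : ℝ) / (4 + D))) :
    sampleModeRegret r mhat X I n ω ≤ modeRegret θ I n ω +
      ((l * Real.log n + (l * Real.log n) ^ 2) + K) * (n : ℝ) ^ (((3 : ℝ) + D) / (4 + D)) := by
  have : Nonempty (Fin K) := ⟨best⟩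
  have hn0 : (0 : ℝ) < n := by exact_mod_cast hn
  have hn1 : (1 : ℝ) ≤ n := by exact_mod_cast hn
  set a : ℝ := ((3 : ℝ) + D) / (4 + D) with ha
  have ha2 : 1 / 2 ≤ a := by
    rw [ha, div_le_div_iff₀ (by norm_num) (by positivity)]
    linarith [(Nat.cast_nonneg D : (0 : ℝ) ≤ D)]
  set q : ℝ := l * Real.log n with hq
  have hq0 : 0 ≤ q := mul_nonneg hl0 (Real.log_nonneg hn1)
  have hna : 1 ≤ (n : ℝ) ^ a := Real.one_le_rpow hn1 (by linarith)
  have hsup : (⨆ i, (n : ℝ) * r (mhat (fullSample X i n ω))) ≤ n * θ best + q * (n : ℝ) ^ a := by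
    refine ciSup_le fun i => ?_
    have h1 := (abs_le.1 (hfull i)).2
    have h2 := mul_le_mul_of_nonneg_left h1 hn0.le
    rw [mul_div_rpow_eq hn] at h2
    linarith [mul_le_mul_of_nonneg_left (hbest i) hn0.le]
  have harm : ∀ i, (pulls I i n ω : ℝ) * θ i -
      (1 + q ^ 2 * ((pulls I i n ω : ℝ) / n)) * (n : ℝ) ^ a ≤
        pulls I i n ω * r (mhat (observed X I i n ω)) := by
    intro i
    have hTn := ModalBandit.pulls_le I i n ω
    set T : ℕ := pulls I i n ω with hT
    rcases Nat.lt_or_ge T 2 with hlt | hge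
    · have hT1 : (T : ℝ) ≤ 1 := by exact_mod_cast (by omega : T ≤ 1)
      have h1 : 1 ≤ (1 + q ^ 2 * ((T : ℝ) / n)) * (n : ℝ) ^ a := by
        have : 1 ≤ 1 + q ^ 2 * ((T : ℝ) / n) := le_add_of_nonneg_right (by positivity)
        exact one_le_mul_of_one_le_of_one_le this hna
      have h2 : (T : ℝ) * θ i ≤ 1 := mul_le_one₀ hT1 (hθ i).1 (hθ i).2
      have h3 : 0 ≤ (T : ℝ) * r (mhat (observed X I i n ω)) :=
        mul_nonneg (Nat.cast_nonneg T) (hr _).1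
      linarith
    · have h1 := (abs_le.1 (hgood i n le_rfl hge)).1
      rw [← hT] at h1
      have hT0 : (0 : ℝ) < T := by exact_mod_cast (by omega : 0 < T)
      have h2 := mul_le_mul_of_nonneg_left h1 hT0.le
      rw [mul_neg, mul_div_rpow_eq (by omega)] at h2
      have hlog : l * Real.log T ≤ q :=
        mul_le_mul_of_nonneg_left (Real.log_le_log hT0 (by exact_mod_cast hTn)) hl0
      have h3 : l * Real.log T * (T : ℝ) ^ a ≤ q * (T : ℝ) ^ a :=
        mul_le_mul_of_nonneg_right hlog (by positivity)
      linarith [mul_rpow_le_of_le ha2 hq0 hTn hn]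
  have hsum := Finset.sum_le_sum fun i (_ : i ∈ (Finset.univ : Finset (Fin K))) => harm i
  rw [Finset.sum_sub_distrib, ← Finset.sum_mul, Finset.sum_add_distrib, ← Finset.mul_sum,
    ← Finset.sum_div, sum_pulls, div_self hn0.ne'] at hsum
  simp only [Finset.sum_const, Finset.card_univ, Fintype.card_fin, nsmul_eq_mul, mul_one] at hsum
  rw [modeRegret_eq_sum hbest, sampleModeRegret]
  simp only [mul_sub, Finset.sum_sub_distrib]
  rw [← Finset.sum_mul, sum_pulls]
  linarith

end Regret

end

/-! ### Union bound over the arms -/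

section

section Failure

variable {D K : ℕ} {f : Fin K → Space D → ℝ} {m : Fin K → Space D}

/-- For one arm, the confidence widths are correct simultaneously for all observed samples of the
first `n` rounds and for the full sample, up to probability `6 n² exp (-l² / 8)`. -/
theorem exists_confidence_failure_le (hD : 1 ≤ D) {i : Fin K} (hf : IsModalDensity (f i) (m i))
    {r : Space D → ℝ} {L : NNReal} (hL : LipschitzWith L r) (hr : ∀ x, r x ∈ Set.Icc (0 : ℝ) 1) :
    ∃ l₀ : ℝ, ∀ l, l₀ ≤ l → ∀ n : ℕ, 2 ≤ n →
      ∀ (Ω : Type u) [MeasurableSpace Ω] (μ : Measure Ω) [IsProbabilityMeasure μ]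
        (X : Fin K → ℕ → Ω → Space D) (mhat : Set (Space D) → Space D) (I : ℕ → Ω → Fin K),
        IsRewardTable μ f X → IsModeEstimator mhat →
        (∀ t, 1 ≤ t → t ≤ n → Measurable[past X t] (I t)) →
        μ {ω | ¬ ((∀ t ≤ n, 2 ≤ pulls I i t ω → |r (mhat (observed X I i t ω)) - r (m i)| ≤
            l * Real.log (pulls I i t ω) / (pulls I i t ω : ℝ) ^ ((1 : ℝ) / (4 + D))) ∧
          |r (mhat (fullSample X i n ω)) - r (m i)| ≤
            l * Real.log n / (n : ℝ) ^ ((1 : ℝ) / (4 + D)))} ≤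
          ENNReal.ofReal (6 * n ^ 2 * Real.exp (-(l ^ 2 / 8))) := by
  obtain ⟨l₀, hconc⟩ := hf.exists_score_concentration hD hL hr
  refine ⟨l₀, fun l hl n hn Ω mΩ μ _ X mhat I hX hmhat hI => ?_⟩
  have hmono := tablePast_mono X
  have hle := hX.tablePast_le
  have hW := measurable_tablePast_succ X i
  have hind := hX.indep_tablePast i
  have hlaw := hX.law i
  have hsel := measurableSet_pullEvents hI i
  have hinf := infinite_pullEvents I i n
  set Y : ℕ → Ω → Space D := sampled (X i) (pullEvents I i n) with hY
  set w : ℕ → ℝ := fun T => l * Real.log T / (T : ℝ) ^ ((1 : ℝ) / (4 + D)) with hw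
  have hskip : ∀ T, 2 ≤ T → μ {ω | w T < |r (mhat ((fun j => Y j ω) '' Set.Iio T)) - r (m i)|} ≤
      ENNReal.ofReal (3 * T * Real.exp (-(l ^ 2 / 8))) := fun T hT =>
    hconc l hl T hT Ω μ Y (iIndepFun_sampled hmono hle hW hind hlaw hsel hinf)
      (measurable_sampled hmono hle hW hsel hinf)
      (map_sampled hmono hle hW hind hlaw hsel hinf) mhat hmhat
  have hall : μ {ω | w n < |r (mhat ((fun j => X i (j + 1) ω) '' Set.Iio n)) - r (m i)|} ≤
      ENNReal.ofReal (3 * n * Real.exp (-(l ^ 2 / 8))) := by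
    refine hconc l hl n hn Ω μ (fun j => X i (j + 1)) ?_ (fun j => hX.measurable i _)
      (fun j => hX.law i _) mhat hmhat
    exact hX.indep.precomp (g := fun j : ℕ => (i, j + 1)) fun a b hab => by simpa using hab
  have hn1 : (1 : ℝ) ≤ n := by exact_mod_cast (by omega : 1 ≤ n)
  calc _ ≤ μ ((⋃ T ∈ Finset.Icc 2 n,
          {ω | w T < |r (mhat ((fun j => Y j ω) '' Set.Iio T)) - r (m i)|}) ∪
        {ω | w n < |r (mhat ((fun j => X i (j + 1) ω) '' Set.Iio n)) - r (m i)|}) := by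
        refine measure_mono fun ω hω => ?_
        by_contra hcon
        refine hω ⟨fun t ht hpulls => ?_, ?_⟩
        · by_contra! hlt
          refine hcon (Or.inl ?_)
          simp only [Set.mem_iUnion]
          refine ⟨pulls I i t ω, Finset.mem_Icc.2 ⟨hpulls, (pulls_le I i t ω).trans ht⟩, ?_⟩
          rw [observed_eq_image ht] at hlt
          exact hlt
        · by_contra! hlt
          refine hcon (Or.inr ?_)
          rw [fullSample_eq_image] at hlt
          exact hlt
    _ ≤ (∑ _T ∈ Finset.Icc 2 n, ENNReal.ofReal (3 * n * Real.exp (-(l ^ 2 / 8)))) +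
        ENNReal.ofReal (3 * n * Real.exp (-(l ^ 2 / 8))) := by
        refine (measure_union_le _ _).trans (add_le_add ?_ hall)
        refine (measure_biUnion_finset_le _ _).trans (Finset.sum_le_sum fun T hT => ?_)
        obtain ⟨hT2, hTn⟩ := Finset.mem_Icc.1 hT
        refine (hskip T hT2).trans (ENNReal.ofReal_le_ofReal ?_)
        gcongr
    _ = ENNReal.ofReal (n * (3 * n * Real.exp (-(l ^ 2 / 8)))) := by
        rw [Finset.sum_const, Nat.card_Icc, ENNReal.ofReal_mul (Nat.cast_nonneg n),
          ENNReal.ofReal_natCast, ← succ_nsmul, nsmul_eq_mul]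
        congr 2
        omega
    _ ≤ ENNReal.ofReal (6 * n ^ 2 * Real.exp (-(l ^ 2 / 8))) := by
        refine ENNReal.ofReal_le_ofReal ?_
        have : 0 ≤ (n : ℝ) ^ 2 * Real.exp (-(l ^ 2 / 8)) := by positivity
        linarith

end Failure

theorem polyLog_regret (D : ℕ) (x y : ℝ) :
    polyLog (MvPolynomial.C 2 * (MvPolynomial.C 2 * (MvPolynomial.X 0 + MvPolynomial.X 1) *
      MvPolynomial.X 1) ^ (4 + D)) x y =
        2 * (2 * (Real.log x + Real.log y) * Real.log y) ^ (4 + D) := by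
  simp [polyLog]

theorem polyLog_sample (x y : ℝ) :
    polyLog ((MvPolynomial.X 0 + MvPolynomial.X 1) * MvPolynomial.X 1 +
      ((MvPolynomial.X 0 + MvPolynomial.X 1) * MvPolynomial.X 1) ^ 2) x y =
        (Real.log x + Real.log y) * Real.log y + ((Real.log x + Real.log y) * Real.log y) ^ 2 := by
  simp [polyLog]

/-- With `l = log (n / δ)` the failure probabilities of all the arms add up to at most `δ`: once
`l ≥ 32`, the Gaussian-type tail `exp (-l² / 8)` is at most `(δ / n) ^ 4`. -/
theorem card_mul_failure_le {K n : ℕ} {δ : ℝ} (hδ0 : 0 < δ) (hδ1 : δ < 1) (hn : 0 < n)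
    (hK : 6 * K ≤ n) (hl : 32 ≤ Real.log (n / δ)) :
    K * (6 * n ^ 2 * Real.exp (-(Real.log (n / δ) ^ 2 / 8))) ≤ δ := by
  have hn0 : (0 : ℝ) < n := by exact_mod_cast hn
  have hn1 : (1 : ℝ) ≤ n := by exact_mod_cast hn
  have hK' : 6 * (K : ℝ) ≤ n := by exact_mod_cast hK
  set l := Real.log (n / δ) with hldef
  have hexp : Real.exp (-(l ^ 2 / 8)) ≤ (δ / n) ^ 4 := by
    have h1 : Real.exp (-l) = δ / n := by
      rw [Real.exp_neg, hldef, Real.exp_log (by positivity), inv_div]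
    rw [← h1, ← Real.exp_nat_mul, Real.exp_le_exp]
    push_cast
    linarith [mul_le_mul_of_nonneg_right hl (by linarith : 0 ≤ l)]
  have hδ4 : δ ^ 4 ≤ δ := pow_le_of_le_one hδ0.le hδ1.le (by norm_num)
  calc K * (6 * n ^ 2 * Real.exp (-(l ^ 2 / 8)))
      = 6 * K * n ^ 2 * Real.exp (-(l ^ 2 / 8)) := by ring
    _ ≤ n * n ^ 2 * (δ / n) ^ 4 := by gcongr
    _ = δ ^ 4 / n := by field_simp
    _ ≤ δ ^ 4 := div_le_self (by positivity) hn1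
    _ ≤ δ := hδ4

end

end ModalBandit

open ModalBandit
theorem mainTheorem5 (D : ℕ) (hD : 1 ≤ D) :
    ∃ (P Q : MvPolynomial (Fin 2) ℝ) (C : ℝ), 0 < C ∧
      ∀ (K : ℕ) (f : Fin K → Space D → ℝ) (m : Fin K → Space D) (r : Space D → ℝ) (L : NNReal)
        (best : Fin K),
        (∀ i, IsModalDensity (f i) (m i)) →
        LipschitzWith L r → (∀ x, r x ∈ Set.Icc (0 : ℝ) 1) →
        (∀ i, i ≠ best → r (m i) < r (m best)) →
        ∃ N : ℕ, ∀ (n : ℕ), N ≤ n → ∀ (δ : ℝ), 0 < δ → δ < 1 →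
          ∀ (Ω : Type*) [MeasurableSpace Ω] (μ : Measure Ω) [IsProbabilityMeasure μ]
            (X : Fin K → ℕ → Ω → Space D) (mhat : Set (Space D) → Space D)
            (I : ℕ → Ω → Fin K),
            IsRewardTable μ f X → IsModeEstimator mhat → IsUCBRun r mhat X n (δ / n) I →
            μ {ω | ¬ (modeRegret (fun i => r (m i)) I n ω ≤
                  polyLog P (1 / δ) n *
                    ∑ i with i ≠ best, (r (m best) - r (m i)) ^ (-((3 : ℝ) + D)) ∧
                sampleModeRegret r mhat X I n ω ≤
                  modeRegret (fun i => r (m i)) I n ω +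
                    C * ((polyLog Q (1 / δ) n + K) * (n : ℝ) ^ (((3 : ℝ) + D) / (4 + D))))}
              ≤ ENNReal.ofReal δ := by
  refine ⟨MvPolynomial.C 2 * (MvPolynomial.C 2 * (MvPolynomial.X 0 + MvPolynomial.X 1) *
      MvPolynomial.X 1) ^ (4 + D),
    (MvPolynomial.X 0 + MvPolynomial.X 1) * MvPolynomial.X 1 +
      ((MvPolynomial.X 0 + MvPolynomial.X 1) * MvPolynomial.X 1) ^ 2, 1, one_pos,
    fun K f m r L best hf hL hr hbest => ?_⟩
  choose l₀ hl₀ using fun i => exists_confidence_failure_le hD (hf i) hL hr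
  have hlog : ∀ᶠ n : ℕ in Filter.atTop, 32 + ∑ i, |l₀ i| ≤ Real.log n :=
    (Real.tendsto_log_atTop.comp tendsto_natCast_atTop_atTop).eventually_ge_atTop _
  obtain ⟨N, hN⟩ := Filter.eventually_atTop.1 (hlog.and (Filter.eventually_ge_atTop (6 * K + 2)))
  refine ⟨N, fun n hn δ hδ0 hδ1 Ω _ μ _ X mhat I hX hmhat hrun => ?_⟩
  obtain ⟨hlogn, hnK⟩ := hN n hn
  have hn0 : (0 : ℝ) < n := by exact_mod_cast (by omega : 0 < n)
  have hsum0 : 0 ≤ ∑ i, |l₀ i| := Finset.sum_nonneg fun i _ => abs_nonneg _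
  set l : ℝ := Real.log (n / δ) with hl
  have hlsplit : l = Real.log (1 / δ) + Real.log n := by
    rw [hl, Real.log_div hn0.ne' hδ0.ne', one_div, Real.log_inv]
    ring
  have hδlog : 0 ≤ Real.log (1 / δ) := Real.log_nonneg (by rw [le_div_iff₀ hδ0]; linarith)
  have hln : 32 + ∑ i, |l₀ i| ≤ l := by linarith
  have hli : ∀ i, l₀ i ≤ l := fun i => by
    linarith [le_abs_self (l₀ i), Finset.single_le_sum (fun j _ => abs_nonneg (l₀ j))
      (Finset.mem_univ i)]
  have hθ : ∀ i, r (m i) ∈ Set.Icc (0 : ℝ) 1 := fun i => hr _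
  have hbest' : ∀ i, r (m i) ≤ r (m best) := by
    intro i
    rcases eq_or_ne i best with rfl | hi
    · exact le_rfl
    · exact (hbest i hi).le
  -- `mhat` and the runs need not be measurable: the bound is on outer measures
  calc _ ≤ μ (⋃ i : Fin K,
          {ω | ¬ ((∀ t ≤ n, 2 ≤ pulls I i t ω → |r (mhat (observed X I i t ω)) - r (m i)| ≤
            l * Real.log (pulls I i t ω) / (pulls I i t ω : ℝ) ^ ((1 : ℝ) / (4 + D))) ∧
          |r (mhat (fullSample X i n ω)) - r (m i)| ≤
            l * Real.log n / (n : ℝ) ^ ((1 : ℝ) / (4 + D)))}) := by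
        refine measure_mono fun ω hω => ?_
        by_contra hcon
        have hgood : ∀ i, _ := fun i => not_not.1 fun h => hcon (Set.mem_iUnion.2 ⟨i, h⟩)
        refine hω ⟨?_, ?_⟩
        · rw [polyLog_regret, ← hlsplit]
          refine modeRegret_le hrun (by rw [one_div_div]) (by linarith) ?_ hθ hbest
            fun j => (hgood j).1
          have : 1 * 1 ≤ 2 * l * Real.log n :=
            mul_le_mul (by linarith) (by linarith) zero_le_one (by linarith)
          linarith
        · rw [polyLog_sample, ← hlsplit, one_mul]
          exact sampleModeRegret_le (by omega) (by linarith) hr hθ hbest' (fun j => (hgood j).1)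
            fun j => (hgood j).2
    _ ≤ ∑ _i : Fin K, ENNReal.ofReal (6 * n ^ 2 * Real.exp (-(l ^ 2 / 8))) := by
        refine (measure_iUnion_fintype_le _ _).trans (Finset.sum_le_sum fun i _ => ?_)
        exact hl₀ i l (hli i) n (by omega) Ω μ X mhat I hX hmhat hrun.predictable
    _ = ENNReal.ofReal (K * (6 * n ^ 2 * Real.exp (-(l ^ 2 / 8)))) := by
        rw [Finset.sum_const, Finset.card_univ, Fintype.card_fin, nsmul_eq_mul,
          ENNReal.ofReal_mul (Nat.cast_nonneg K), ENNReal.ofReal_natCast]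
    _ ≤ ENNReal.ofReal δ :=
        ENNReal.ofReal_le_ofReal (card_mul_failure_le hδ0 hδ1 (by omega) (by omega) (by linarith))
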